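/- Let $1<a\le b<a^2$ and $\delta\ge 0$, and set $\tau:=\log_a b$. Let $(X,d)$ be a connected, noncompact, complete metric space such that - $d$ is strictly intrinsic ($X$ is a length space): any two points $x,y\in X$ are joined by a continuous path of length $d(x,y)$; - $X$ is $\delta$-hyperbolic: with $(y,z)_x:=\tfrac12\big(d(x,y)+d(x,z)-d(y,z)\big)$, one has $(x,z)_w\ge\min\big((x,y)_w,(y,z)_w\big)-\delta$ for all $x,y,z,w\in X$. Write $B_r(x):=\{y\in X: d(x,y)<r\}$, and let $\mu$ be a Borel measure on $X$ such that - $\mu$ is locally doubling: $0<\mu(B_r(x))<\infty$ for all $x\in X$ and $r>0$, and for every $s>0$ there is a constant $L_s$ such that $\mu(B_{2r}(x))\le L_s\,\mu(B_r(x))$ for all $x\in X$ and $0<r\le s$; - $\mu$ has $(a,b)$-pinched exponential growth at infinity: there are constants $c,C>0$ such that $c\,a^r\le\mu(B_r(x))\le C\,b^r$ for all $x\in X$ and all $r\ge 1$. Let $\mathcal M f(x):=\sup_{r>0}\frac1{\mu(B_r(x))}\int_{B_r(x)}|f|\,d\mu$ be the centred Hardy–Littlewood maximal operator. Then: 1.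 for every $p\in(\tau,\infty]$, $\mathcal M$ is bounded on $L^p(X)$, that is, there is a constant $K$ such that for every $f\in L^p(X)$ the function $\mathcal M f$ is $\mu$-measurable and $\|\mathcal M f\|_{L^p(X)}\le K\,\|f\|_{L^p(X)}$; 2. $\mathcal M$ is of weak type $(\tau,\tau)$, that is, there is a constant $K$ such that for every $f\in L^\tau(X)$ the function $\mathcal M f$ is $\mu$-measurable and $\mu(\{x\in X:\mathcal M f(x)>\alpha\})\le K\,\alpha^{-\tau}\,\|f\|_{L^\tau(X)}^\tau$ for all $\alpha>0$. -/

import Mathlib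

open MeasureTheory Set
open scoped ENNReal NNReal

/-- `(X, d)` is a length space with strictly intrinsic metric: any two points are joined by a
continuous path whose length (total variation) equals their distance. -/
def IsStrictlyIntrinsic (X : Type*) [MetricSpace X] : Prop :=
  ∀ x y : X, ∃ γ : Path x y, eVariationOn (fun t : unitInterval => γ t) univ = edist x y

/-- The Gromov product `(y, z)_x`. -/
noncomputable def gromovProduct {X : Type*} [MetricSpace X] (x y z : X) : ℝ :=
  (dist x y + dist x z - dist y z) / 2

/-- The four points condition with constant `δ`. -/
def IsGromovHyperbolic (X : Type*) [MetricSpace X] (δ : ℝ) : Prop :=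
  ∀ x y z w : X,
    min (gromovProduct w x y) (gromovProduct w y z) - δ ≤ gromovProduct w x z

/-- All balls have positive finite measure, and for every `s > 0` there is a doubling constant
`L` valid for all balls of radius at most `s`. -/
structure IsLocallyDoubling {X : Type*} [MetricSpace X] [MeasurableSpace X]
    (μ : Measure X) : Prop where
  ball_pos : ∀ (x : X) (r : ℝ), 0 < r → 0 < μ (Metric.ball x r)
  ball_lt_top : ∀ (x : X) (r : ℝ), 0 < r → μ (Metric.ball x r) < ∞
  doubling : ∀ s : ℝ, 0 < s → ∃ L : ℝ≥0, ∀ (x : X) (r : ℝ), 0 < r → r ≤ s →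
    μ (Metric.ball x (2 * r)) ≤ L * μ (Metric.ball x r)

/-- `(a, b)`-pinched exponential growth at infinity. -/
def HasPinchedExpGrowth {X : Type*} [MetricSpace X] [MeasurableSpace X]
    (μ : Measure X) (a b : ℝ) : Prop :=
  ∃ c C : ℝ, 0 < c ∧ 0 < C ∧ ∀ (x : X) (r : ℝ), 1 ≤ r →
    ENNReal.ofReal (c * a ^ r) ≤ μ (Metric.ball x r) ∧
      μ (Metric.ball x r) ≤ ENNReal.ofReal (C * b ^ r)

/-- The centred Hardy–Littlewood maximal function, with values in `[0, ∞]`. -/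
noncomputable def maximalFunction {X : Type*} [MetricSpace X] [MeasurableSpace X]
    (μ : Measure X) (f : X → ℂ) (x : X) : ℝ≥0∞ :=
  ⨆ (r : ℝ) (_ : 0 < r),
    (μ (Metric.ball x r))⁻¹ * ∫⁻ y in Metric.ball x r, ‖f y‖ₑ ∂μ

/-- `T` is bounded on `L^p(μ)`, where `p ∈ (0, ∞]`. -/
def IsBoundedOnLp {X : Type*} [MeasurableSpace X] (μ : Measure X)
    (T : (X → ℂ) → X → ℝ≥0∞) (p : ℝ≥0∞) : Prop :=
  ∃ K : ℝ≥0, ∀ f : X → ℂ, MemLp f p μ →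
    AEMeasurable (T f) μ ∧ eLpNorm (T f) p μ ≤ K * eLpNorm f p μ

/-- `T` is of weak type `(p, p)`, where `0 < p < ∞`. -/
def IsWeakType {X : Type*} [MeasurableSpace X] (μ : Measure X)
    (T : (X → ℂ) → X → ℝ≥0∞) (p : ℝ) : Prop :=
  ∃ K : ℝ≥0, ∀ f : X → ℂ, MemLp f (ENNReal.ofReal p) μ →
    AEMeasurable (T f) μ ∧
      ∀ α : ℝ≥0, 0 < α →
        μ {x | (α : ℝ≥0∞) < T f x} ≤ K * (eLpNorm f (ENNReal.ofReal p) μ / α) ^ p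

/-!
Radii at most `1` are controlled by the Vitali covering lemma and local doubling, and interpolating
the weak type `(τ, τ)` with `L^∞` gives the strong bounds; the point is the weak type for radii
`r > 1`.

Put `n = ⌈r⌉`. If the average of `F` over `B(x, r)` exceeds `t`, then replacing `F` by its averages
at unit scale and truncating these at height about `t a ^ n` yields a function `u ≤ 1` with
`∫_{B(x, n + 2)} u` bounded below. Hyperbolicity bounds the size of `{x | A < ∫_{B(x, n)} u}`: for
a base point `o`, the part of `B(x, n)` on which `d(o, y) ≤ d(o, x) + s` (a horoball) lies in a ball
of radius about `(n + s) / 2`, so the weight `w(x, y) = b ^ ((n + d(o, y) - d(o, x)) / 2)` satisfies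
`μ {y ∈ B(x, n) | w(x, y) ≤ ρ} ≲ ρ`, and, since `w(x, y) w(y, x) = b ^ n`, also
`μ {x ∈ B(y, n) | w(x, y) > ρ} ≲ b ^ n / ρ`. Splitting `∫_{B(x, n)} u` along
`w(x, y) ≤ ε u(y) ^ (1 - q)` for `1 ≤ q < 2`, the first part is uniformly small by the layer cake
formula, while Chebyshev's inequality applied to the second gives the bound `K b ^ n ∫ u ^ q`. Since
`b = a ^ τ` with `τ < 2`, one may take `q > τ`, and the sum over `n` becomes geometric.
-/

section Averages

variable {α : Type*} {_ : MeasurableSpace α} {μ : Measure α}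

theorem inv_measure_univ_smul_le_one (μ : Measure α) : ((μ univ)⁻¹ • μ) univ ≤ 1 := by
  rw [Measure.smul_apply, smul_eq_mul, mul_comm]
  exact ENNReal.mul_inv_le_one _

theorem laverage_add_const_le (f : α → ℝ≥0∞) (c : ℝ≥0∞) :
    ⨍⁻ x, (f x + c) ∂μ ≤ ⨍⁻ x, f x ∂μ + c := by
  rw [laverage, laverage, lintegral_add_right _ measurable_const, lintegral_const]
  gcongr
  exact mul_le_of_le_one_right' (inv_measure_univ_smul_le_one μ)

theorem laverage_rpow_le {p : ℝ} (hp : 1 ≤ p) {f : α → ℝ≥0∞} (hf : AEMeasurable f μ) :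
    (⨍⁻ x, f x ∂μ) ^ p ≤ ⨍⁻ x, f x ^ p ∂μ := by
  have hp0 : 0 < p := one_pos.trans_le hp
  have hJ := eLpNorm_le_eLpNorm_mul_rpow_measure_univ (p := 1) (q := ENNReal.ofReal p)
    (by simpa using hp) (hf.smul_measure (μ univ)⁻¹).aestronglyMeasurable
  rw [eLpNorm_one_eq_lintegral_enorm, eLpNorm_eq_lintegral_rpow_enorm_toReal (by simpa using hp0)
    ENNReal.ofReal_ne_top, ENNReal.toReal_ofReal hp0.le, ENNReal.toReal_one, div_one] at hJ
  calc (⨍⁻ x, f x ∂μ) ^ p ≤ ((⨍⁻ x, f x ^ p ∂μ) ^ (1 / p)) ^ p := by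
        gcongr
        refine hJ.trans (mul_le_of_le_one_right' (ENNReal.rpow_le_one ?_ ?_))
        · exact inv_measure_univ_smul_le_one μ
        · exact sub_nonneg.2 ((div_le_one hp0).2 hp)
    _ = ⨍⁻ x, f x ^ p ∂μ := by
        rw [← ENNReal.rpow_mul, one_div_mul_cancel hp0.ne', ENNReal.rpow_one]

end Averages

section BallAverages

open Metric

variable {X : Type*} [PseudoMetricSpace X] [MeasurableSpace X] {μ : Measure X} {F G : X → ℝ≥0∞}

theorem measure_ball_eq_iSup_rat (ν : Measure X) (x : X) {l r : ℝ} (hlr : l < r) :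
    ν (ball x r) = ⨆ q ∈ {q : ℚ | l < q ∧ (q : ℝ) < r}, ν (ball x q) := by
  have hmono : Monotone fun q : ℚ => ball x (q : ℝ) := fun p q hpq =>
    ball_subset_ball (Rat.cast_le.2 hpq)
  rw [← measure_biUnion_eq_iSup (to_countable _)
    fun p hp q hq => ⟨max p q, by rcases max_choice p q with h | h <;> simpa only [h],
      hmono (le_max_left p q), hmono (le_max_right p q)⟩]
  congr 1
  ext y
  simp only [mem_ball, mem_iUnion, mem_ofPred_eq, exists_prop]
  refine ⟨fun hy => ?_, fun ⟨q, hq, hyq⟩ => hyq.trans hq.2⟩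
  obtain ⟨q, hq, hqr⟩ := exists_rat_btwn (max_lt hlr hy)
  exact ⟨q, ⟨(le_max_left _ _).trans_lt hq, hqr⟩, (le_max_right _ _).trans_lt hq⟩

theorem lowerSemicontinuous_measure_ball (ν : Measure X) (r : ℝ) :
    LowerSemicontinuous fun x => ν (ball x r) := by
  intro x t (ht : t < ν (ball x r))
  rw [measure_ball_eq_iSup_rat ν x (sub_one_lt r)] at ht
  obtain ⟨q, ⟨-, hqr⟩, htq⟩ : ∃ q : ℚ, (r - 1 < q ∧ (q : ℝ) < r) ∧ t < ν (ball x q) := by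
    simpa only [lt_iSup_iff, exists_prop, mem_ofPred_eq] using ht
  filter_upwards [ball_mem_nhds x (sub_pos.2 hqr)] with y hy
  refine htq.trans_le (measure_mono (ball_subset_ball' ?_))
  rw [mem_ball'] at hy
  linarith

/-- The mean of `F` over the ball of radius `r` centred at `x`. -/
noncomputable def ballAverage (μ : Measure X) (r : ℝ) (F : X → ℝ≥0∞) (x : X) : ℝ≥0∞ :=
  ⨍⁻ y in ball x r, F y ∂μ

/-- The centred maximal operator whose radii are restricted to `I`. -/
noncomputable def truncatedMaximal (μ : Measure X) (I : Set ℝ) (F : X → ℝ≥0∞) (x : X) : ℝ≥0∞ :=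
  ⨆ r ∈ I, ballAverage μ r F x

theorem ballAverage_eq_div (μ : Measure X) (r : ℝ) (F : X → ℝ≥0∞) (x : X) :
    ballAverage μ r F x = (∫⁻ y in ball x r, F y ∂μ) / μ (ball x r) :=
  setLAverage_eq ..

theorem ballAverage_mono (h : F ≤ G) (r : ℝ) : ballAverage μ r F ≤ ballAverage μ r G :=
  fun _ => lintegral_mono h

theorem ballAverage_add_const_le (r : ℝ) (F : X → ℝ≥0∞) (c : ℝ≥0∞) (x : X) :
    ballAverage μ r (fun y => F y + c) x ≤ ballAverage μ r F x + c :=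
  laverage_add_const_le F c

theorem truncatedMaximal_le_add_const {I : Set ℝ} {c : ℝ≥0∞} (h : ∀ x, F x ≤ G x + c) (x : X) :
    truncatedMaximal μ I F x ≤ truncatedMaximal μ I G x + c :=
  iSup₂_le fun r hr => (ballAverage_mono h r x).trans <|
    (ballAverage_add_const_le r G c x).trans <| by
      gcongr
      exact le_iSup₂_of_le r hr le_rfl

theorem truncatedMaximal_congr_ae (I : Set ℝ) (h : F =ᵐ[μ] G) :
    truncatedMaximal μ I F = truncatedMaximal μ I G := by
  ext x
  exact biSup_congr fun r _ => laverage_congr (ae_restrict_of_ae h)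

theorem truncatedMaximal_le_essSup (I : Set ℝ) (F : X → ℝ≥0∞) (x : X) :
    truncatedMaximal μ I F x ≤ essSup F μ :=
  iSup₂_le fun r _ => setLAverage_le_essSup (ball x r) F

theorem truncatedMaximal_union (μ : Measure X) (I J : Set ℝ) (F : X → ℝ≥0∞) (x : X) :
    truncatedMaximal μ (I ∪ J) F x = truncatedMaximal μ I F x ⊔ truncatedMaximal μ J F x :=
  iSup_union

theorem truncatedMaximal_rpow_le (I : Set ℝ) {p : ℝ} (hp : 1 ≤ p) (hF : AEMeasurable F μ)
    (x : X) :
    truncatedMaximal μ I F x ^ p ≤ truncatedMaximal μ I (fun y => F y ^ p) x := by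
  rw [← ENNReal.le_rpow_inv_iff (by positivity)]
  refine iSup₂_le fun r hr => (ENNReal.le_rpow_inv_iff (by positivity)).2 ?_
  exact (laverage_rpow_le hp hF.restrict).trans (le_iSup₂_of_le r hr le_rfl)

section Measurability

variable [OpensMeasurableSpace X]

theorem measurable_measure_ball (ν : Measure X) (r : ℝ) : Measurable fun x => ν (ball x r) :=
  (lowerSemicontinuous_measure_ball ν r).measurable

theorem measurable_setLIntegral_ball (μ : Measure X) (F : X → ℝ≥0∞) (r : ℝ) :
    Measurable fun x => ∫⁻ y in ball x r, F y ∂μ := by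
  simpa only [withDensity_apply _ measurableSet_ball] using
    measurable_measure_ball (μ.withDensity F) r

theorem measurable_ballAverage (μ : Measure X) (r : ℝ) (F : X → ℝ≥0∞) :
    Measurable (ballAverage μ r F) := by
  rw [funext (ballAverage_eq_div μ r F)]
  exact (measurable_setLIntegral_ball μ F r).div (measurable_measure_ball μ r)

theorem truncatedMaximal_eq_iSup_rat {I : Set ℝ} (hI : IsOpen I) (μ : Measure X)
    (F : X → ℝ≥0∞) (x : X) :
    truncatedMaximal μ I F x = ⨆ q ∈ {q : ℚ | (q : ℝ) ∈ I}, ballAverage μ q F x := by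
  refine le_antisymm (iSup₂_le fun r hr => ?_)
    (iSup₂_le fun q hq => le_iSup₂_of_le (q : ℝ) hq le_rfl)
  obtain ⟨l, hlr, hlI⟩ := exists_Ioc_subset_of_mem_nhds (hI.mem_nhds hr) ⟨r - 1, sub_one_lt r⟩
  have hsup := measure_ball_eq_iSup_rat (μ.withDensity F) x hlr
  simp only [withDensity_apply _ measurableSet_ball] at hsup
  rw [ballAverage_eq_div, hsup]
  simp only [ENNReal.iSup_div]
  refine iSup₂_le fun q hq => le_iSup₂_of_le q (hlI ⟨hq.1, hq.2.le⟩) ?_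
  rw [ballAverage_eq_div]
  gcongr
  exact hq.2.le

theorem measurable_truncatedMaximal {I : Set ℝ} (hI : IsOpen I) (μ : Measure X)
    (F : X → ℝ≥0∞) : Measurable (truncatedMaximal μ I F) := by
  rw [funext (truncatedMaximal_eq_iSup_rat hI μ F)]
  exact .biSup _ (to_countable _) fun q _ => measurable_ballAverage μ q F

end Measurability

end BallAverages

section Interpolation

variable {α : Type*} [MeasurableSpace α] {μ : Measure α} {T : (α → ℝ≥0∞) → α → ℝ≥0∞}
  {f F : α → ℝ≥0∞} {p τ : ℝ}

theorem lintegral_Ioi_rpow_eq_top (s : ℝ) :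
    ∫⁻ t in Ioi (0 : ℝ), ENNReal.ofReal (t ^ s) = ∞ := by
  by_contra h
  refine not_integrableOn_Ioi_rpow s <| (lintegral_ofReal_ne_top_iff_integrable
    (by fun_prop) ?_).1 h
  exact ae_restrict_of_forall_mem measurableSet_Ioi fun t ht => Real.rpow_nonneg (le_of_lt ht) s

theorem lintegral_rpow_eq_lintegral_measure_lt (hf : AEMeasurable f μ) (hp : 0 < p) :
    ∫⁻ x, f x ^ p ∂μ = ENNReal.ofReal p *
      ∫⁻ t in Ioi (0 : ℝ), μ {x | ENNReal.ofReal t < f x} * ENNReal.ofReal (t ^ (p - 1)) := by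
  by_cases htop : ∀ᵐ x ∂μ, f x ≠ ∞
  · have hreal := lintegral_rpow_eq_lintegral_meas_lt_mul μ
      (Filter.Eventually.of_forall fun x => (f x).toReal_nonneg) hf.ennreal_toReal hp
    convert hreal using 1
    · refine lintegral_congr_ae (htop.mono fun x hx => ?_)
      change f x ^ p = ENNReal.ofReal ((f x).toReal ^ p)
      rw [← ENNReal.ofReal_rpow_of_nonneg ENNReal.toReal_nonneg hp.le, ENNReal.ofReal_toReal hx]
    · congr 1
      refine setLIntegral_congr_fun measurableSet_Ioi fun t (ht : 0 < t) => ?_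
      congr 1
      exact measure_congr (htop.mono fun x hx =>
        propext (ENNReal.ofReal_lt_iff_lt_toReal ht.le hx))
  · have hpos : μ {x | f x = ∞} ≠ 0 := by simpa [ae_iff] using htop
    have hleft : ∫⁻ x, f x ^ p ∂μ = ∞ := by
      by_contra h
      refine htop ((ae_lt_top' (hf.pow_const p) h).mono fun x hx hfx => ?_)
      rw [hfx, ENNReal.top_rpow_of_pos hp] at hx
      exact hx.ne rfl
    have hright : ∫⁻ t in Ioi (0 : ℝ),
        μ {x | ENNReal.ofReal t < f x} * ENNReal.ofReal (t ^ (p - 1)) = ∞ := by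
      refine top_le_iff.1 ?_
      calc ∞ = μ {x | f x = ∞} * ∫⁻ t in Ioi (0 : ℝ), ENNReal.ofReal (t ^ (p - 1)) := by
            rw [lintegral_Ioi_rpow_eq_top, ENNReal.mul_top hpos]
        _ = ∫⁻ t in Ioi (0 : ℝ), μ {x | f x = ∞} * ENNReal.ofReal (t ^ (p - 1)) :=
            (lintegral_const_mul _ (by fun_prop)).symm
        _ ≤ _ := by
            gcongr with t x
            rintro (hx : f x = ∞)
            exact hx ▸ ENNReal.ofReal_lt_top
    rw [hleft, hright, ENNReal.mul_top (by simpa using hp)]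

/-- The weak type `(p, p)` inequality for an operator on nonnegative measurable functions. -/
def IsWeakTypeOnNonneg (μ : Measure α) (T : (α → ℝ≥0∞) → α → ℝ≥0∞) (p : ℝ) : Prop :=
  ∃ K : ℝ≥0, ∀ F, Measurable F → ∀ t : ℝ≥0∞, t ≠ 0 → t ≠ ∞ →
    μ {x | t < T F x} ≤ K * (∫⁻ x, F x ^ p ∂μ) / t ^ p

theorem IsWeakTypeOnNonneg.sup {T' : (α → ℝ≥0∞) → α → ℝ≥0∞} (hT : IsWeakTypeOnNonneg μ T p)
    (hT' : IsWeakTypeOnNonneg μ T' p) : IsWeakTypeOnNonneg μ (fun F x => T F x ⊔ T' F x) p := by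
  obtain ⟨K, hK⟩ := hT
  obtain ⟨K', hK'⟩ := hT'
  refine ⟨K + K', fun F hF t ht0 ht => ?_⟩
  calc μ {x | t < T F x ⊔ T' F x} ≤ μ {x | t < T F x} + μ {x | t < T' F x} := by
        simp only [lt_sup_iff]
        exact measure_union_le {x | t < T F x} {x | t < T' F x}
    _ ≤ K * (∫⁻ x, F x ^ p ∂μ) / t ^ p + K' * (∫⁻ x, F x ^ p ∂μ) / t ^ p :=
        add_le_add (hK F hF t ht0 ht) (hK' F hF t ht0 ht)
    _ = (K + K' : ℝ≥0) * (∫⁻ x, F x ^ p ∂μ) / t ^ p := by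
        rw [ENNReal.div_add_div_same, ← add_mul, ENNReal.coe_add]

theorem measure_lt_le_withDensity (hτ : 0 < τ) {K : ℝ≥0}
    (hadd : ∀ (F G : α → ℝ≥0∞) (c : ℝ≥0∞), (∀ x, F x ≤ G x + c) → ∀ x, T F x ≤ T G x + c)
    (hK : ∀ F, Measurable F → ∀ t : ℝ≥0∞, t ≠ 0 → t ≠ ∞ →
      μ {x | t < T F x} ≤ K * (∫⁻ x, F x ^ τ ∂μ) / t ^ τ)
    (hF : Measurable F) {t : ℝ≥0∞} (ht0 : t ≠ 0) (ht : t ≠ ∞) :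
    μ {x | t < T F x} ≤
      K * 2 ^ τ * (μ.withDensity (fun x => F x ^ τ) {x | t < 2 * F x} / t ^ τ) := by
  have hS : MeasurableSet {x | t < 2 * F x} := measurableSet_lt measurable_const (hF.const_mul 2)
  set G : α → ℝ≥0∞ := {x | t < 2 * F x}.indicator F with hG
  have hFG : ∀ x, F x ≤ G x + t / 2 := fun x => by
    by_cases hx : x ∈ {x | t < 2 * F x}
    · simp only [hG, indicator_of_mem hx, le_self_add]
    · rw [hG, indicator_of_notMem hx, zero_add, ENNReal.le_div_iff_mul_le (by simp) (by simp),
        mul_comm]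
      exact not_lt.1 hx
  have hGint : ∫⁻ x, G x ^ τ ∂μ = μ.withDensity (fun x => F x ^ τ) {x | t < 2 * F x} := by
    rw [withDensity_apply _ hS, ← lintegral_indicator hS]
    refine lintegral_congr fun x => ?_
    by_cases hx : x ∈ {x | t < 2 * F x}
    · simp only [hG, indicator_of_mem hx]
    · simp only [hG, indicator_of_notMem hx, ENNReal.zero_rpow_of_pos hτ]
  calc μ {x | t < T F x} ≤ μ {x | t / 2 < T G x} := measure_mono fun x (hx : t < T F x) => by
        by_contra hle
        refine (hx.trans_le (hadd F G _ hFG x)).not_ge ?_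
        calc T G x + t / 2 ≤ t / 2 + t / 2 := by gcongr; exact not_lt.1 hle
          _ = t := ENNReal.add_halves t
    _ ≤ K * (∫⁻ x, G x ^ τ ∂μ) / (t / 2) ^ τ :=
        hK G (hF.indicator hS) (t / 2) (by simp [ht0]) (ENNReal.div_ne_top ht (by simp))
    _ = _ := by
        rw [hGint, ENNReal.div_rpow_of_nonneg _ _ hτ.le, div_eq_mul_inv _ (t ^ τ / 2 ^ τ),
          ENNReal.inv_div (Or.inl (ENNReal.rpow_ne_top_of_nonneg hτ.le (by simp)))
            (Or.inl (by simp)), div_eq_mul_inv, div_eq_mul_inv]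
        ring

theorem lintegral_rpow_le_of_measure_lt_le {ν : Measure α} {G H : α → ℝ≥0∞} {A : ℝ≥0∞}
    (hA : A ≠ ∞) (hG : AEMeasurable G μ) (hH : AEMeasurable H ν) (hp : 0 < p) (hτ : τ < p)
    (h : ∀ t : ℝ, 0 < t → μ {x | ENNReal.ofReal t < G x} ≤
      A * (ν {x | ENNReal.ofReal t < H x} / ENNReal.ofReal t ^ τ)) :
    ∫⁻ x, G x ^ p ∂μ ≤
      A * (ENNReal.ofReal p / ENNReal.ofReal (p - τ)) * ∫⁻ x, H x ^ (p - τ) ∂ν := by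
  have hpτ : 0 < p - τ := sub_pos.2 hτ
  have hlevel : ∀ t ∈ Ioi (0 : ℝ),
      μ {x | ENNReal.ofReal t < G x} * ENNReal.ofReal (t ^ (p - 1)) ≤
        A * (ν {x | ENNReal.ofReal t < H x} * ENNReal.ofReal (t ^ (p - τ - 1))) := by
    intro t (ht : 0 < t)
    have hpow : ENNReal.ofReal (t ^ (p - τ - 1)) =
        ENNReal.ofReal (t ^ (p - 1)) / ENNReal.ofReal t ^ τ := by
      rw [ENNReal.ofReal_rpow_of_pos ht, ← ENNReal.ofReal_div_of_pos (by positivity),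
        ← Real.rpow_sub ht]
      ring_nf
    grw [h t ht, hpow]
    simp only [div_eq_mul_inv]
    exact le_of_eq (by ring)
  set J := ∫⁻ t in Ioi (0 : ℝ),
    ν {x | ENNReal.ofReal t < H x} * ENNReal.ofReal (t ^ (p - τ - 1)) with hJ
  calc ∫⁻ x, G x ^ p ∂μ
      = ENNReal.ofReal p * ∫⁻ t in Ioi (0 : ℝ),
          μ {x | ENNReal.ofReal t < G x} * ENNReal.ofReal (t ^ (p - 1)) :=
        lintegral_rpow_eq_lintegral_measure_lt hG hp
    _ ≤ ENNReal.ofReal p * ∫⁻ t in Ioi (0 : ℝ), A *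
          (ν {x | ENNReal.ofReal t < H x} * ENNReal.ofReal (t ^ (p - τ - 1))) := by
        gcongr _ * ?_
        exact setLIntegral_mono' measurableSet_Ioi hlevel
    _ = ENNReal.ofReal p * (A * J) := by rw [lintegral_const_mul' _ _ hA]
    _ = A * (ENNReal.ofReal p / ENNReal.ofReal (p - τ)) * (ENNReal.ofReal (p - τ) * J) := by
        rw [mul_assoc A, ← mul_assoc (_ / _), ENNReal.div_mul_cancel (by simpa using hτ)
          ENNReal.ofReal_ne_top]
        ring
    _ = _ := by rw [hJ, ← lintegral_rpow_eq_lintegral_measure_lt hH hpτ]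

/-- Marcinkiewicz interpolation, where `hadd` plays the role of sublinearity and boundedness on
`L^∞`. -/
theorem IsWeakTypeOnNonneg.exists_lintegral_rpow_le (hT : IsWeakTypeOnNonneg μ T τ) (hτ : 0 < τ)
    (hp : τ < p) (hmeas : ∀ F, Measurable F → Measurable (T F))
    (hadd : ∀ (F G : α → ℝ≥0∞) (c : ℝ≥0∞), (∀ x, F x ≤ G x + c) → ∀ x, T F x ≤ T G x + c) :
    ∃ K : ℝ≥0, ∀ F, Measurable F → ∫⁻ x, T F x ^ p ∂μ ≤ K * ∫⁻ x, F x ^ p ∂μ := by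
  obtain ⟨K, hK⟩ := hT
  have hpτ : 0 < p - τ := sub_pos.2 hp
  obtain ⟨K', hK'⟩ : ∃ K' : ℝ≥0, (K' : ℝ≥0∞) =
      K * 2 ^ τ * (ENNReal.ofReal p / ENNReal.ofReal (p - τ)) * 2 ^ (p - τ) :=
    ⟨_, ENNReal.coe_toNNReal (by finiteness [(ENNReal.ofReal_pos.2 hpτ).ne'])⟩
  refine ⟨K', fun F hF => ?_⟩
  have hdens : ∫⁻ x, (2 * F x) ^ (p - τ) ∂(μ.withDensity fun x => F x ^ τ) =
      2 ^ (p - τ) * ∫⁻ x, F x ^ p ∂μ := by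
    rw [lintegral_withDensity_eq_lintegral_mul _ (hF.pow_const τ) (by fun_prop),
      ← lintegral_const_mul _ (hF.pow_const p)]
    refine lintegral_congr fun x => ?_
    have hsplit := ENNReal.rpow_add_of_nonneg (x := F x) τ (p - τ) hτ.le hpτ.le
    rw [add_sub_cancel] at hsplit
    rw [Pi.mul_apply, ENNReal.mul_rpow_of_nonneg _ _ hpτ.le, hsplit]
    ring
  rw [hK', mul_assoc _ (2 ^ (p - τ)), ← hdens]
  exact lintegral_rpow_le_of_measure_lt_le (by finiteness) (hmeas F hF).aemeasurable
    (hF.const_mul 2).aemeasurable (hτ.trans hp) hp fun t ht =>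
      measure_lt_le_withDensity hτ hadd hK hF (by simpa using ht) ENNReal.ofReal_ne_top

end Interpolation

theorem lintegral_mul_setLIntegral_swap {α β : Type*} [MeasurableSpace α] [MeasurableSpace β]
    {μ : Measure α} {ν : Measure β} [SFinite μ] [SFinite ν] {E : Set (α × β)}
    (hE : MeasurableSet E) {f : α → ℝ≥0∞} {g : β → ℝ≥0∞} (hf : Measurable f)
    (hg : Measurable g) :
    ∫⁻ x, f x * ∫⁻ y in {y | (x, y) ∈ E}, g y ∂ν ∂μ =
      ∫⁻ y, g y * ∫⁻ x in {x | (x, y) ∈ E}, f x ∂μ ∂ν := by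
  have hfg : Measurable (E.indicator fun z => f z.1 * g z.2) :=
    ((hf.comp measurable_fst).mul (hg.comp measurable_snd)).indicator hE
  calc ∫⁻ x, f x * ∫⁻ y in {y | (x, y) ∈ E}, g y ∂ν ∂μ
      = ∫⁻ x, ∫⁻ y, E.indicator (fun z => f z.1 * g z.2) (x, y) ∂ν ∂μ := by
        refine lintegral_congr fun x => ?_
        have hs : MeasurableSet {y | (x, y) ∈ E} := measurable_prodMk_left hE
        rw [← lintegral_const_mul _ hg, ← lintegral_indicator hs]
        rfl
    _ = ∫⁻ y, ∫⁻ x, E.indicator (fun z => f z.1 * g z.2) (x, y) ∂μ ∂ν :=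
        lintegral_lintegral_swap hfg.aemeasurable
    _ = ∫⁻ y, g y * ∫⁻ x in {x | (x, y) ∈ E}, f x ∂μ ∂ν := by
        refine lintegral_congr fun y => ?_
        have hs : MeasurableSet {x | (x, y) ∈ E} := measurable_prodMk_right hE
        rw [← lintegral_const_mul _ hf, ← lintegral_indicator hs]
        simp only [mul_comm (g y)]
        rfl

section BallIntegrals

open Metric

variable {X : Type*} [PseudoMetricSpace X] [MeasurableSpace X] [OpensMeasurableSpace X]
  [SecondCountableTopology X] {μ : Measure X} [SFinite μ] {F G : X → ℝ≥0∞}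

theorem lintegral_mul_setLIntegral_ball_swap (hF : Measurable F) (hG : Measurable G) (r : ℝ) :
    ∫⁻ x, F x * ∫⁻ y in ball x r, G y ∂μ ∂μ = ∫⁻ y, G y * ∫⁻ x in ball y r, F x ∂μ ∂μ := by
  have hE : MeasurableSet {p : X × X | dist p.2 p.1 < r} :=
    measurableSet_lt (by fun_prop) (by fun_prop)
  refine (lintegral_mul_setLIntegral_swap hE hF hG).trans (lintegral_congr fun y => ?_)
  have hball : {x | (x, y) ∈ {p : X × X | dist p.2 p.1 < r}} = ball y r :=
    Set.ext fun x => mem_ball'.symm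
  rw [hball]

theorem lintegral_ballAverage (hF : Measurable F) (s : ℝ) :
    ∫⁻ y, ballAverage μ s F y ∂μ = ∫⁻ z, F z * ∫⁻ y in ball z s, (μ (ball y s))⁻¹ ∂μ ∂μ := by
  simp only [ballAverage_eq_div, ENNReal.div_eq_inv_mul]
  exact lintegral_mul_setLIntegral_ball_swap (measurable_measure_ball μ s).inv hF s

end BallIntegrals

section LocallyDoubling

open Metric

variable {X : Type*} [MetricSpace X] [MeasurableSpace X] {μ : Measure X} {F : X → ℝ≥0∞}

namespace IsLocallyDoubling

theorem exists_measure_ball_two_pow_mul_le (h : IsLocallyDoubling μ) (k : ℕ) {s : ℝ}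
    (hs : 0 < s) : ∃ L : ℝ≥0, ∀ (x : X) (r : ℝ), 0 < r → r ≤ s →
      μ (ball x (2 ^ k * r)) ≤ L * μ (ball x r) := by
  induction k with
  | zero => exact ⟨1, fun x r _ _ => by simp⟩
  | succ k ih =>
    obtain ⟨L, hL⟩ := ih
    obtain ⟨L', hL'⟩ := h.doubling (2 ^ k * s) (by positivity)
    refine ⟨L' * L, fun x r hr hrs => ?_⟩
    calc μ (ball x (2 ^ (k + 1) * r)) = μ (ball x (2 * (2 ^ k * r))) := by ring_nf
      _ ≤ L' * μ (ball x (2 ^ k * r)) := hL' x _ (by positivity) (by gcongr)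
      _ ≤ L' * (L * μ (ball x r)) := by gcongr; exact hL x r hr hrs
      _ = (L' * L : ℝ≥0) * μ (ball x r) := by rw [ENNReal.coe_mul, mul_assoc]

theorem exists_measure_ball_le (h : IsLocallyDoubling μ) (R d : ℝ) {r : ℝ} (hr : 0 < r) :
    ∃ L : ℝ≥0, 0 < L ∧ ∀ x y : X, dist x y ≤ d → μ (ball x R) ≤ L * μ (ball y r) := by
  obtain ⟨k, hk⟩ := pow_unbounded_of_one_lt ((R + d) / r) one_lt_two
  obtain ⟨L, hL⟩ := h.exists_measure_ball_two_pow_mul_le k hr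
  refine ⟨L + 1, by positivity, fun x y hxy => ?_⟩
  calc μ (ball x R) ≤ μ (ball y (2 ^ k * r)) := by
        refine measure_mono (ball_subset_ball' ?_)
        linarith [(div_lt_iff₀ hr).1 hk]
    _ ≤ L * μ (ball y r) := hL y r hr le_rfl
    _ ≤ (L + 1 : ℝ≥0) * μ (ball y r) := by gcongr; exact le_self_add

theorem sigmaFinite (h : IsLocallyDoubling μ) : SigmaFinite μ := by
  rcases isEmpty_or_nonempty X with _ | ⟨⟨o⟩⟩
  · rw [μ.eq_zero_of_isEmpty]
    infer_instance
  · refine ⟨⟨⟨fun n : ℕ => ball o (n + 1), fun _ => trivial,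
      fun n => h.ball_lt_top o _ (by positivity), eq_univ_of_forall fun x => mem_iUnion.2 ?_⟩⟩⟩
    obtain ⟨n, hn⟩ := exists_nat_gt (dist x o)
    exact ⟨n, hn.trans (lt_add_one _)⟩

theorem measure_ball_le_of_lt_ballAverage (h : IsLocallyDoubling μ) {r : ℝ} (hr : 0 < r)
    {t : ℝ≥0∞} (ht0 : t ≠ 0) (ht : t ≠ ∞) {x : X} (hx : t < ballAverage μ r F x) :
    μ (ball x r) ≤ (∫⁻ y in ball x r, F y ∂μ) / t := by
  rw [ENNReal.le_div_iff_mul_le (Or.inl ht0) (Or.inl ht),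
    ← measure_mul_setLAverage F (h.ball_lt_top x r hr).ne]
  gcongr
  exact hx.le

theorem exists_ballAverage_le_ballAverage (h : IsLocallyDoubling μ) {s : ℝ} (hs : 0 < s) :
    ∃ L : ℝ≥0, ∀ (F : X → ℝ≥0∞) (y z : X), dist z y < s →
      ballAverage μ s F y ≤ L * ballAverage μ (2 * s) F z := by
  obtain ⟨L, hL0, hL⟩ := h.exists_measure_ball_le (2 * s) s hs
  have hLne : (L : ℝ≥0∞) ≠ 0 := by simpa using hL0.ne'
  refine ⟨L, fun F y z hzy => ?_⟩
  rw [ballAverage_eq_div, ballAverage_eq_div]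
  calc (∫⁻ x in ball y s, F x ∂μ) / μ (ball y s)
      ≤ (∫⁻ x in ball z (2 * s), F x ∂μ) / (μ (ball z (2 * s)) / L) := by
        gcongr
        · exact ball_subset_ball' (by rw [dist_comm]; linarith)
        · exact ENNReal.div_le_of_le_mul' (hL z y hzy.le)
    _ = L * ((∫⁻ x in ball z (2 * s), F x ∂μ) / μ (ball z (2 * s))) := by
        rw [div_eq_mul_inv, ENNReal.inv_div (Or.inl ENNReal.coe_ne_top) (Or.inl hLne),
          div_eq_mul_inv, div_eq_mul_inv]
        ring

variable [OpensMeasurableSpace X]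

theorem countable_of_pairwiseDisjoint (h : IsLocallyDoubling μ) {ι : Type*} {u : Set ι}
    {c : ι → X} {r : ι → ℝ} (hr : ∀ i ∈ u, 0 < r i)
    (hd : u.PairwiseDisjoint fun i => ball (c i) (r i)) : u.Countable := by
  have := h.sigmaFinite
  have hcount := Measure.countable_meas_pos_of_disjoint_iUnion (μ := μ)
    (As := fun i : u => ball (c i) (r i)) (fun _ => measurableSet_ball)
    (fun i j hij => hd i.2 j.2 (Subtype.coe_ne_coe.2 hij))
  have huniv : {i : u | 0 < μ (ball (c i) (r i))} = univ :=
    eq_univ_of_forall fun i => h.ball_pos _ _ (hr i i.2)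
  rw [huniv] at hcount
  exact countable_coe_iff.1 (countable_univ_iff.1 hcount)

theorem secondCountableTopology (h : IsLocallyDoubling μ) : SecondCountableTopology X := by
  refine secondCountable_of_almost_dense_set fun ε hε => ?_
  obtain ⟨u, -, hdisj, hcover⟩ := Vitali.exists_disjoint_subfamily_covering_enlargement_closedBall
    (univ : Set X) id (fun _ => ε / 5) (ε / 5) (fun _ _ => le_rfl) 5 (by norm_num)
  refine ⟨u, h.countable_of_pairwiseDisjoint (fun _ _ => by positivity)
    (hdisj.mono fun _ => ball_subset_closedBall), fun x => ?_⟩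
  obtain ⟨y, hy, hxy⟩ := hcover x trivial
  refine ⟨y, hy, (hxy (mem_closedBall_self (by positivity))).trans_eq ?_⟩
  ring

theorem isWeakTypeOnNonneg_truncatedMaximal_one (h : IsLocallyDoubling μ) {R : ℝ} (hR : 0 < R) :
    IsWeakTypeOnNonneg μ (truncatedMaximal μ (Ioc 0 R)) 1 := by
  obtain ⟨L, hL⟩ := h.exists_measure_ball_two_pow_mul_le 3 hR
  refine ⟨L, fun F _ t ht0 ht => ?_⟩
  obtain ⟨u, hu, hdisj, hcover⟩ :=
    Vitali.exists_disjoint_subfamily_covering_enlargement_closedBall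
      {p : X × ℝ | p.2 ∈ Ioc 0 R ∧ t < ballAverage μ p.2 F p.1} Prod.fst Prod.snd R
      (fun p hp => hp.1.2) 5 (by norm_num)
  replace hdisj : u.PairwiseDisjoint fun p => ball p.1 p.2 :=
    hdisj.mono fun _ => ball_subset_closedBall
  have hcount : u.Countable := h.countable_of_pairwiseDisjoint (fun p hp => (hu hp).1.1) hdisj
  have hsub : {x | t < truncatedMaximal μ (Ioc 0 R) F x} ⊆ ⋃ p ∈ u, ball p.1 (2 ^ 3 * p.2) := by
    intro x hx
    obtain ⟨r, hr, hlt⟩ : ∃ r ∈ Ioc 0 R, t < ballAverage μ r F x := by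
      simpa only [truncatedMaximal, mem_ofPred_eq, lt_iSup_iff, exists_prop] using hx
    obtain ⟨p, hp, hsub⟩ := hcover (x, r) ⟨hr, hlt⟩
    have hxp := hsub (mem_closedBall_self hr.1.le)
    refine mem_iUnion₂.2 ⟨p, hp, (mem_closedBall.1 hxp).trans_lt ?_⟩
    linarith [(hu hp).1.1]
  have hball : ∀ p ∈ u, μ (ball p.1 (2 ^ 3 * p.2)) ≤ L / t * ∫⁻ y in ball p.1 p.2, F y ∂μ := by
    intro p hp
    obtain ⟨⟨hp0, hpR⟩, hlt⟩ := hu hp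
    grw [hL p.1 p.2 hp0 hpR, h.measure_ball_le_of_lt_ballAverage hp0 ht0 ht hlt]
    simp only [div_eq_mul_inv]
    exact le_of_eq (by ring)
  calc μ {x | t < truncatedMaximal μ (Ioc 0 R) F x}
      ≤ ∑' p : u, μ (ball p.1.1 (2 ^ 3 * p.1.2)) :=
        (measure_mono hsub).trans (measure_biUnion_le _ hcount _)
    _ ≤ ∑' p : u, L / t * ∫⁻ y in ball p.1.1 p.1.2, F y ∂μ :=
        ENNReal.tsum_le_tsum fun p => hball p p.2
    _ = L / t * ∫⁻ y in ⋃ p ∈ u, ball p.1 p.2, F y ∂μ := by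
        rw [ENNReal.tsum_mul_left, lintegral_biUnion hcount (fun _ _ => measurableSet_ball) hdisj]
    _ ≤ L / t * ∫⁻ y, F y ∂μ := by gcongr; exact Measure.restrict_le_self
    _ = L * (∫⁻ y, F y ^ (1 : ℝ) ∂μ) / t ^ (1 : ℝ) := by
        simp only [ENNReal.rpow_one, ENNReal.mul_div_right_comm]

theorem isWeakTypeOnNonneg_truncatedMaximal (h : IsLocallyDoubling μ) {R p : ℝ} (hR : 0 < R)
    (hp : 1 ≤ p) : IsWeakTypeOnNonneg μ (truncatedMaximal μ (Ioc 0 R)) p := by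
  obtain ⟨K, hK⟩ := h.isWeakTypeOnNonneg_truncatedMaximal_one hR
  refine ⟨K, fun F hF t ht0 ht => ?_⟩
  have hp0 : 0 < p := one_pos.trans_le hp
  calc μ {x | t < truncatedMaximal μ (Ioc 0 R) F x}
      ≤ μ {x | t ^ p < truncatedMaximal μ (Ioc 0 R) (fun y => F y ^ p) x} :=
        measure_mono fun x hx => (ENNReal.rpow_lt_rpow hx hp0).trans_le
          (truncatedMaximal_rpow_le _ hp hF.aemeasurable x)
    _ ≤ K * (∫⁻ x, F x ^ p ∂μ) / t ^ p := by
        simpa only [ENNReal.rpow_one] using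
          hK _ (hF.pow_const p) (t ^ p) (by simp [ht0, ht]) (by simp [ht0, ht])

theorem exists_lintegral_inv_measure_ball_bounds (h : IsLocallyDoubling μ) {s : ℝ} (hs : 0 < s) :
    ∃ L : ℝ≥0, 0 < L ∧ ∀ z : X, (L : ℝ≥0∞)⁻¹ ≤ ∫⁻ y in ball z s, (μ (ball y s))⁻¹ ∂μ ∧
      ∫⁻ y in ball z s, (μ (ball y s))⁻¹ ∂μ ≤ L := by
  obtain ⟨L, hL0, hL⟩ := h.exists_measure_ball_le s s hs
  refine ⟨L, hL0, fun z => ?_⟩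
  have hz0 := (h.ball_pos z s hs).ne'
  have hz := (h.ball_lt_top z s hs).ne
  have hLne : (L : ℝ≥0∞) ≠ 0 := by simpa using hL0.ne'
  constructor
  · calc (L : ℝ≥0∞)⁻¹ = ∫⁻ _ in ball z s, (L * μ (ball z s))⁻¹ ∂μ := by
          rw [setLIntegral_const, ENNReal.mul_inv (Or.inl hLne) (Or.inl ENNReal.coe_ne_top),
            mul_assoc, ENNReal.inv_mul_cancel hz0 hz, mul_one]
      _ ≤ _ := setLIntegral_mono (measurable_measure_ball μ s).inv fun y hy =>
          ENNReal.inv_le_inv.2 (hL y z (mem_ball.1 hy).le)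
  · calc ∫⁻ y in ball z s, (μ (ball y s))⁻¹ ∂μ ≤ ∫⁻ _ in ball z s, (μ (ball z s) / L)⁻¹ ∂μ :=
          setLIntegral_mono measurable_const fun y hy => ENNReal.inv_le_inv.2 <|
            ENNReal.div_le_of_le_mul' (hL z y (mem_ball'.1 hy).le)
      _ = L := by
          rw [setLIntegral_const, ENNReal.inv_div (Or.inl ENNReal.coe_ne_top) (Or.inl hLne),
            ENNReal.div_mul_cancel hz0 hz]

theorem exists_lintegral_ballAverage_bounds (h : IsLocallyDoubling μ) {s : ℝ} (hs : 0 < s) :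
    ∃ L : ℝ≥0, 0 < L ∧ ∀ F : X → ℝ≥0∞, Measurable F →
      ∫⁻ y, F y ∂μ ≤ L * ∫⁻ y, ballAverage μ s F y ∂μ ∧
      ∫⁻ y, ballAverage μ s F y ∂μ ≤ L * ∫⁻ y, F y ∂μ := by
  have := h.sigmaFinite
  have := h.secondCountableTopology
  obtain ⟨L, hL0, hL⟩ := h.exists_lintegral_inv_measure_ball_bounds hs
  have hLne : (L : ℝ≥0∞) ≠ 0 := by simpa using hL0.ne'
  refine ⟨L, hL0, fun F hF => ?_⟩
  rw [lintegral_ballAverage hF, ← lintegral_const_mul _ hF,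
    ← lintegral_const_mul' _ _ ENNReal.coe_ne_top]
  refine ⟨lintegral_mono fun z => ?_, lintegral_mono fun z => ?_⟩
  · calc F z = L * (F z * (L : ℝ≥0∞)⁻¹) := by
          rw [mul_left_comm, ENNReal.mul_inv_cancel hLne ENNReal.coe_ne_top, mul_one]
      _ ≤ _ := by gcongr; exact (hL z).1
  · rw [mul_comm (L : ℝ≥0∞)]
    gcongr
    exact (hL z).2

theorem exists_setLIntegral_ball_le (h : IsLocallyDoubling μ) {s : ℝ} (hs : 0 < s) :
    ∃ L : ℝ≥0, 0 < L ∧ ∀ F : X → ℝ≥0∞, Measurable F → ∀ (x : X) (r : ℝ),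
      ∫⁻ y in ball x r, F y ∂μ ≤ L * ∫⁻ y in ball x (r + s), ballAverage μ s F y ∂μ := by
  obtain ⟨L, hL0, hL⟩ := h.exists_lintegral_ballAverage_bounds hs
  refine ⟨L, hL0, fun F hF x r => ?_⟩
  rw [← lintegral_indicator measurableSet_ball, ← lintegral_indicator measurableSet_ball]
  refine (hL _ (hF.indicator measurableSet_ball)).1.trans ?_
  gcongr with y
  by_cases hy : y ∈ ball x (r + s)
  · rw [indicator_of_mem hy]
    exact ballAverage_mono (indicator_le_self _ F) s y
  · have hzero : EqOn ((ball x r).indicator F) 0 (ball y s) := fun z hz => by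
      refine indicator_of_notMem (fun hzx => hy ?_) F
      rw [mem_ball] at hzx ⊢
      linarith [dist_triangle_left y x z, mem_ball.1 hz]
    rw [indicator_of_notMem hy, ballAverage, setLAverage_congr_fun measurableSet_ball hzero]
    simp

theorem exists_lintegral_ballAverage_rpow_le (h : IsLocallyDoubling μ) {s p : ℝ} (hs : 0 < s)
    (hp : 1 ≤ p) :
    ∃ L : ℝ≥0, ∀ F : X → ℝ≥0∞, Measurable F →
      ∫⁻ y, ballAverage μ s F y ^ p ∂μ ≤ L * ∫⁻ y, F y ^ p ∂μ := by
  obtain ⟨L, -, hL⟩ := h.exists_lintegral_ballAverage_bounds hs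
  exact ⟨L, fun F hF => (lintegral_mono fun y => laverage_rpow_le hp hF.aemeasurable).trans
    (hL _ (hF.pow_const p)).2⟩

end IsLocallyDoubling

end LocallyDoubling

section KernelBound

variable {α β : Type*} [MeasurableSpace α] [MeasurableSpace β] {μ : Measure α} {ν : Measure β}
  {K B ε : ℝ≥0∞} {q : ℝ}

theorem measurable_setLIntegral_section [SFinite ν] {E : Set (α × β)} (hE : MeasurableSet E)
    {g : β → ℝ≥0∞} (hg : Measurable g) : Measurable fun x => ∫⁻ y in {y | (x, y) ∈ E}, g y ∂ν := by
  have hs : ∀ x, MeasurableSet {y | (x, y) ∈ E} := fun x => measurable_prodMk_left hE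
  simp only [← lintegral_indicator (hs _)]
  exact ((hg.comp measurable_snd).indicator hE).lintegral_prod_right'

theorem lintegral_Ioo_rpow {s : ℝ} (hs : -1 < s) :
    ∫⁻ t in Ioo (0 : ℝ) 1, ENNReal.ofReal (t ^ s) = (ENNReal.ofReal (s + 1))⁻¹ := by
  have hs1 : 0 < s + 1 := by linarith
  rw [← ofReal_integral_eq_lintegral_ofReal, ← integral_Ioc_eq_integral_Ioo,
    ← intervalIntegral.integral_of_le zero_le_one, integral_rpow (Or.inl hs), Real.one_rpow,
    Real.zero_rpow hs1.ne', sub_zero, one_div, ENNReal.ofReal_inv_of_pos hs1]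
  · exact (intervalIntegral.integrableOn_Ioo_rpow_iff one_pos).2 hs
  · exact ae_restrict_of_forall_mem measurableSet_Ioo fun t ht => Real.rpow_nonneg ht.1.le s

theorem setLIntegral_le_of_measure_le {ψ u : β → ℝ≥0∞} (hψ : ∀ ρ, ν {y | ψ y ≤ ρ} ≤ K * ρ)
    (hu : Measurable u) (hu1 : ∀ y, u y ≤ 1) (hq1 : 1 ≤ q) (hq2 : q < 2) (ε : ℝ≥0∞) :
    ∫⁻ y in {y | ψ y ≤ ε * u y ^ (1 - q)}, u y ∂ν ≤ K * (ε / ENNReal.ofReal (2 - q)) := by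
  set S : Set β := {y | ψ y ≤ ε * u y ^ (1 - q)}
  have hlevel : ∀ t : ℝ, (ν.restrict S) {y | ENNReal.ofReal t < u y} ≤
      K * (ε * ENNReal.ofReal t ^ (1 - q)) := fun t => by
    rw [Measure.restrict_apply (measurableSet_lt measurable_const hu)]
    refine (measure_mono fun y hy => ?_).trans (hψ _)
    obtain ⟨hty, hyS⟩ : ENNReal.ofReal t < u y ∧ ψ y ≤ ε * u y ^ (1 - q) := hy
    refine hyS.trans (mul_right_mono ?_)
    rw [← neg_sub, ENNReal.rpow_neg, ENNReal.rpow_neg]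
    exact ENNReal.inv_le_inv.2 (ENNReal.rpow_le_rpow hty.le (sub_nonneg.2 hq1))
  have hlarge : ∀ t : ℝ, 1 ≤ t → (ν.restrict S) {y | ENNReal.ofReal t < u y} = 0 := fun t ht => by
    have hempty : {y | ENNReal.ofReal t < u y} = ∅ := eq_empty_of_forall_notMem fun y hy =>
      (hy.trans_le (hu1 y)).not_ge (ENNReal.one_le_ofReal.2 ht)
    rw [hempty, measure_empty]
  calc ∫⁻ y in S, u y ∂ν
      = ∫⁻ t in Ioi (0 : ℝ), (ν.restrict S) {y | ENNReal.ofReal t < u y} := by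
        simpa using lintegral_rpow_eq_lintegral_measure_lt (μ := ν.restrict S) hu.aemeasurable
          one_pos
    _ ≤ ∫⁻ t in Ioi (0 : ℝ), (Ioo 0 1).indicator
          (fun t => K * ε * ENNReal.ofReal (t ^ (1 - q))) t := by
        refine setLIntegral_mono' measurableSet_Ioi fun t ht => ?_
        rcases lt_or_ge t 1 with ht1 | ht1
        · rw [indicator_of_mem (show t ∈ Ioo (0 : ℝ) 1 from ⟨ht, ht1⟩), mul_assoc,
            ← ENNReal.ofReal_rpow_of_pos ht]
          exact hlevel t
        · rw [hlarge t ht1]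
          exact bot_le
    _ ≤ ∫⁻ t in Ioo (0 : ℝ) 1, K * ε * ENNReal.ofReal (t ^ (1 - q)) := by
        rw [← lintegral_indicator measurableSet_Ioo]
        exact setLIntegral_le_lintegral _ _
    _ = K * (ε / ENNReal.ofReal (2 - q)) := by
        rw [lintegral_const_mul _ (by fun_prop), lintegral_Ioo_rpow (by linarith), mul_assoc,
          ← div_eq_mul_inv]
        ring_nf

theorem lintegral_setLIntegral_le_of_measure_le [SFinite μ] [SFinite ν] {E : Set (α × β)}
    (hE : MeasurableSet E) {η : α × β → ℝ≥0∞} (hη : Measurable η)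
    (h : ∀ y ρ, μ {x | (x, y) ∈ E ∧ ρ < η (x, y)} ≤ K * (B / ρ)) {u : β → ℝ≥0∞}
    (hu : Measurable u) (hq1 : 1 ≤ q) (hε0 : ε ≠ 0) (hε : ε ≠ ∞) :
    ∫⁻ x, ∫⁻ y in {y | (x, y) ∈ E ∧ ε * u y ^ (1 - q) < η (x, y)}, u y ∂ν ∂μ ≤
      K * (B / ε) * ∫⁻ y, u y ^ q ∂ν := by
  have hE' : MeasurableSet (E ∩ {p | ε * u p.2 ^ (1 - q) < η p}) :=
    hE.inter (measurableSet_lt (((hu.comp measurable_snd).pow_const _).const_mul _) hη)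
  have hswap := lintegral_mul_setLIntegral_swap (μ := μ) (ν := ν) hE'
    (measurable_const (a := (1 : ℝ≥0∞))) hu
  simp only [one_mul, setLIntegral_one] at hswap
  refine hswap.trans_le ?_
  rw [← lintegral_const_mul _ (hu.pow_const q)]
  refine lintegral_mono fun y => ?_
  calc u y * μ {x | (x, y) ∈ E ∧ ε * u y ^ (1 - q) < η (x, y)}
      ≤ u y * (K * (B / (ε * u y ^ (1 - q)))) := by gcongr; exact h y _
    _ = K * (B / ε) * (u y ^ (1 : ℝ) * u y ^ (q - 1)) := by
        rw [div_eq_mul_inv, ENNReal.mul_inv (Or.inl hε0) (Or.inl hε), ← ENNReal.rpow_neg, neg_sub,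
          div_eq_mul_inv, ENNReal.rpow_one]
        ring
    _ = K * (B / ε) * u y ^ q := by
        rw [← ENNReal.rpow_add_of_nonneg _ _ zero_le_one (sub_nonneg.2 hq1), add_sub_cancel]

theorem measure_lt_setLIntegral_le [SFinite μ] [SFinite ν] {E : Set (α × β)}
    (hE : MeasurableSet E) {η : α × β → ℝ≥0∞} (hη : Measurable η)
    (hleft : ∀ x ρ, ν {y | (x, y) ∈ E ∧ η (x, y) ≤ ρ} ≤ K * ρ)
    (hright : ∀ y ρ, μ {x | (x, y) ∈ E ∧ ρ < η (x, y)} ≤ K * (B / ρ)) {u : β → ℝ≥0∞}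
    (hu : Measurable u) (hu1 : ∀ y, u y ≤ 1) (hq1 : 1 ≤ q) (hq2 : q < 2) (hε0 : ε ≠ 0)
    (hε : ε ≠ ∞) {s : ℝ≥0∞} (hs0 : s ≠ 0) (hs : s ≠ ∞) :
    μ {x | K * (ε / ENNReal.ofReal (2 - q)) + s < ∫⁻ y in {y | (x, y) ∈ E}, u y ∂ν} ≤
      K * (B / ε) / s * ∫⁻ y, u y ^ q ∂ν := by
  set bad : α → Set β := fun x => {y | (x, y) ∈ E ∧ ε * u y ^ (1 - q) < η (x, y)}
  have hbad : MeasurableSet {p : α × β | p ∈ E ∧ ε * u p.2 ^ (1 - q) < η p} :=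
    hE.inter (measurableSet_lt (((hu.comp measurable_snd).pow_const _).const_mul _) hη)
  have hle : ∀ x, ∫⁻ y in {y | (x, y) ∈ E}, u y ∂ν ≤
      K * (ε / ENNReal.ofReal (2 - q)) + ∫⁻ y in bad x, u y ∂ν := fun x => by
    have hηx : Measurable fun y => η (x, y) := hη.comp measurable_prodMk_left
    have hgood : MeasurableSet {y | η (x, y) ≤ ε * u y ^ (1 - q)} :=
      measurableSet_le hηx ((hu.pow_const _).const_mul _)
    rw [← lintegral_add_compl u hgood]
    refine add_le_add (setLIntegral_le_of_measure_le (fun ρ => ?_) hu hu1 hq1 hq2 ε) ?_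
    · rw [Measure.restrict_apply (measurableSet_le hηx measurable_const), inter_comm]
      exact hleft x ρ
    · rw [Measure.restrict_restrict hgood.compl, inter_comm]
      exact lintegral_mono_set fun y hy => ⟨hy.1, not_le.1 hy.2⟩
  calc μ {x | K * (ε / ENNReal.ofReal (2 - q)) + s < ∫⁻ y in {y | (x, y) ∈ E}, u y ∂ν}
      ≤ μ {x | s ≤ ∫⁻ y in bad x, u y ∂ν} :=
        measure_mono fun x hx => (lt_of_add_lt_add_left (hx.trans_le (hle x))).le
    _ ≤ (∫⁻ x, ∫⁻ y in bad x, u y ∂ν ∂μ) / s :=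
        meas_ge_le_lintegral_div (measurable_setLIntegral_section hbad hu).aemeasurable hs0 hs
    _ ≤ K * (B / ε) * (∫⁻ y, u y ^ q ∂ν) / s := by
        gcongr
        exact lintegral_setLIntegral_le_of_measure_le hE hη hright hu hq1 hε0 hε
    _ = K * (B / ε) / s * ∫⁻ y, u y ^ q ∂ν := ENNReal.mul_div_right_comm

end KernelBound

section Hyperbolic

open Metric

variable {X : Type*} [MetricSpace X] {δ b : ℝ}

theorem IsStrictlyIntrinsic.exists_dist_eq (h : IsStrictlyIntrinsic X) (x y : X) {t : ℝ}
    (ht0 : 0 ≤ t) (ht : t ≤ dist x y) : ∃ w, dist x w = t ∧ dist w y = dist x y - t := by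
  obtain ⟨γ, hγ⟩ := h x y
  have hcont : Continuous fun s : unitInterval => dist x (γ s) := by fun_prop
  obtain ⟨s, hs⟩ := mem_range_of_exists_le_of_exists_ge (c := t) hcont
    ⟨0, by simpa using ht0⟩ ⟨1, by simpa using ht⟩
  have hsplit : edist (γ 0) (γ s) + edist (γ s) (γ 1) ≤ edist x y := by
    rw [← hγ]
    refine le_trans ?_ (eVariationOn.add_le_union (s := Icc 0 s) (t := Icc s 1) _
      fun a ha b hb => ha.2.trans hb.1) |>.trans (eVariationOn.mono _ (subset_univ _))
    refine add_le_add (eVariationOn.edist_le _ ?_ ?_) (eVariationOn.edist_le _ ?_ ?_) <;>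
      simp [unitInterval.le_one']
  have hsum : dist x (γ s) + dist (γ s) y ≤ dist x y := by
    simpa only [γ.source, γ.target, edist_dist, ← ENNReal.ofReal_add dist_nonneg dist_nonneg,
      ENNReal.ofReal_le_ofReal_iff dist_nonneg] using hsplit
  refine ⟨γ s, hs, ?_⟩
  linarith [dist_triangle x (γ s) y, (show dist x (γ s) = t from hs)]

theorem IsGromovHyperbolic.nonneg [Nonempty X] (h : IsGromovHyperbolic X δ) : 0 ≤ δ := by
  obtain ⟨o⟩ := ‹Nonempty X›
  simpa [gromovProduct] using h o o o o

theorem IsGromovHyperbolic.exists_ball_inter_horoball_subset (hhyp : IsGromovHyperbolic X δ)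
    (hlen : IsStrictlyIntrinsic X) (o x : X) (r s : ℝ) :
    ∃ w, ball x r ∩ {y | dist o y ≤ dist o x + s} ⊆ closedBall w ((r + s) / 2 + 2 * δ) := by
  have : Nonempty X := ⟨o⟩
  have hδ := hhyp.nonneg
  rcases lt_or_ge r s with hrs | hsr
  · exact ⟨x, fun y hy => mem_closedBall.2 (by linarith [mem_ball.1 hy.1])⟩
  obtain ⟨w, how, hwx⟩ := hlen.exists_dist_eq o x (t := max 0 (dist o x + (s - r) / 2))
    (le_max_left _ _) (max_le dist_nonneg (by linarith))
  refine ⟨w, fun y ⟨hyx, hyo⟩ => ?_⟩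
  rw [mem_ball'] at hyx
  rw [mem_ofPred_eq] at hyo
  rw [mem_closedBall']
  have hfour := hhyp w x y o
  simp only [gromovProduct] at hfour
  rcases max_cases 0 (dist o x + (s - r) / 2) with ⟨hmax, hneg⟩ | ⟨hmax, -⟩ <;> rw [hmax] at how hwx
  · linarith [dist_triangle_left w y o]
  · rcases min_choice ((dist o w + dist o x - dist w x) / 2)
      ((dist o x + dist o y - dist x y) / 2) with hmin | hmin <;> rw [hmin] at hfour <;> linarith

/-- The weight `b ^ ((r + d(o, y) - d(o, x)) / 2)`. In a hyperbolic space whose balls of radius `t`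
have measure `O(b ^ t)` it bounds the measure of the part of the ball `ball x r` lying no further
from `o` than `y`; the splitting of the averaging kernel compares it with a threshold. -/
noncomputable def horoballWeight (b : ℝ) (o : X) (r : ℝ) (p : X × X) : ℝ≥0∞ :=
  ENNReal.ofReal (b ^ ((r + (dist o p.2 - dist o p.1)) / 2))

theorem horoballWeight_mul_swap (hb : 0 < b) (o : X) (r : ℝ) (x y : X) :
    horoballWeight b o r (x, y) * horoballWeight b o r (y, x) = ENNReal.ofReal (b ^ r) := by
  rw [horoballWeight, horoballWeight, ← ENNReal.ofReal_mul (by positivity), ← Real.rpow_add hb]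
  ring_nf

variable [MeasurableSpace X] {μ : Measure X} {a : ℝ}

theorem IsGromovHyperbolic.exists_measure_ball_inter_horoball_le (hhyp : IsGromovHyperbolic X δ)
    (hlen : IsStrictlyIntrinsic X) (hexp : HasPinchedExpGrowth μ a b) (hb : 0 < b) :
    ∃ K : ℝ≥0, 0 < K ∧ ∀ (o x : X) (r s : ℝ),
      μ (ball x r ∩ {y | dist o y ≤ dist o x + s}) ≤ K * ENNReal.ofReal (b ^ ((r + s) / 2)) := by
  obtain ⟨c, C, -, hC, hvol⟩ := hexp
  refine ⟨(C * b ^ (2 * δ + 1)).toNNReal, Real.toNNReal_pos.2 (by positivity),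
    fun o x r s => ?_⟩
  rcases lt_or_ge (r + s) 0 with hneg | hpos
  · have hempty : ball x r ∩ {y | dist o y ≤ dist o x + s} = ∅ := by
      refine eq_empty_of_forall_notMem fun y ⟨hyx, hyo⟩ => ?_
      rw [mem_ofPred_eq] at hyo
      linarith [dist_triangle o y x, mem_ball.1 hyx]
    rw [hempty, measure_empty]
    exact bot_le
  have : Nonempty X := ⟨o⟩
  obtain ⟨w, hw⟩ := hhyp.exists_ball_inter_horoball_subset hlen o x r s
  calc μ (ball x r ∩ {y | dist o y ≤ dist o x + s})
      ≤ μ (ball w ((r + s) / 2 + (2 * δ + 1))) :=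
        measure_mono (hw.trans (closedBall_subset_ball (by linarith)))
    _ ≤ ENNReal.ofReal (C * b ^ ((r + s) / 2 + (2 * δ + 1))) :=
        (hvol w _ (by linarith [hhyp.nonneg])).2
    _ = ENNReal.ofReal (C * b ^ (2 * δ + 1)) * ENNReal.ofReal (b ^ ((r + s) / 2)) := by
        rw [← ENNReal.ofReal_mul (by positivity), Real.rpow_add hb]
        ring_nf

theorem measurable_horoballWeight [OpensMeasurableSpace X] [SecondCountableTopology X]
    (b : ℝ) (o : X) (r : ℝ) : Measurable (horoballWeight b o r) := by
  unfold horoballWeight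
  fun_prop

theorem exists_measure_horoballWeight_le (hhyp : IsGromovHyperbolic X δ)
    (hlen : IsStrictlyIntrinsic X) (hexp : HasPinchedExpGrowth μ a b) (hb : 1 < b) :
    ∃ K : ℝ≥0, 0 < K ∧ ∀ (o x : X) (r : ℝ) (ρ : ℝ≥0∞),
      μ {y | y ∈ ball x r ∧ horoballWeight b o r (x, y) ≤ ρ} ≤ K * ρ := by
  have hb0 : 0 < b := one_pos.trans hb
  obtain ⟨K, hK0, hK⟩ := hhyp.exists_measure_ball_inter_horoball_le hlen hexp hb0
  refine ⟨K, hK0, fun o x r ρ => ?_⟩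
  induction ρ with
  | top => simp [ENNReal.mul_top (ENNReal.coe_ne_zero.2 hK0.ne')]
  | coe ρ =>
    rcases eq_zero_or_pos ρ with rfl | hρ
    · have hempty : {y | y ∈ ball x r ∧ horoballWeight b o r (x, y) ≤ (0 : ℝ≥0)} = ∅ :=
        eq_empty_of_forall_notMem fun y hy => hy.2.not_gt
          (ENNReal.ofReal_pos.2 (Real.rpow_pos_of_pos hb0 _))
      rw [hempty, measure_empty]
      exact bot_le
    have hρlog : b ^ Real.logb b ρ = ρ := Real.rpow_logb hb0 hb.ne' hρ
    calc μ {y | y ∈ ball x r ∧ horoballWeight b o r (x, y) ≤ ρ}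
        ≤ μ (ball x r ∩ {y | dist o y ≤ dist o x + (2 * Real.logb b ρ - r)}) := by
          refine measure_mono fun y ⟨hyx, hyρ⟩ => ⟨hyx, ?_⟩
          rw [horoballWeight, ENNReal.ofReal_le_coe, ← hρlog,
            Real.rpow_le_rpow_left_iff hb] at hyρ
          rw [mem_ofPred_eq]
          linarith
      _ ≤ K * ENNReal.ofReal (b ^ ((r + (2 * Real.logb b ρ - r)) / 2)) := hK o x r _
      _ = K * ρ := by
          rw [add_sub_cancel, mul_div_cancel_left₀ _ two_ne_zero, hρlog, ENNReal.ofReal_coe_nnreal]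

theorem measure_lt_horoballWeight_le {o : X} {r : ℝ} {K : ℝ≥0∞} (hb : 0 < b)
    (h : ∀ y ρ, μ {x | x ∈ ball y r ∧ horoballWeight b o r (y, x) ≤ ρ} ≤ K * ρ) (y : X)
    (ρ : ℝ≥0∞) :
    μ {x | y ∈ ball x r ∧ ρ < horoballWeight b o r (x, y)} ≤
      K * (ENNReal.ofReal (b ^ r) / ρ) := by
  refine (measure_mono fun x hx => ?_).trans (h y _)
  obtain ⟨hyx, hρ⟩ : y ∈ ball x r ∧ ρ < horoballWeight b o r (x, y) := hx
  refine ⟨mem_ball_comm.1 hyx, ?_⟩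
  rw [ENNReal.le_div_iff_mul_le (Or.inr (ENNReal.ofReal_pos.2 (by positivity)).ne')
    (Or.inr ENNReal.ofReal_ne_top), ← horoballWeight_mul_swap hb o r y x]
  gcongr

end Hyperbolic

section GeometricSum

variable {a c v x : ℝ≥0∞} {τ q : ℝ}

theorem rpow_mul_min_one_div_rpow_le_of_denom_le (hτ : 0 ≤ τ) (hq : 0 ≤ q) (h : x ≤ c * v) :
    x ^ τ * min 1 (v / x) ^ q ≤ c ^ τ * v ^ τ := by
  rw [← ENNReal.mul_rpow_of_nonneg _ _ hτ]
  calc x ^ τ * min 1 (v / x) ^ q ≤ (c * v) ^ τ * 1 ^ q := by gcongr; exact min_le_left _ _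
    _ = (c * v) ^ τ := by rw [ENNReal.one_rpow, mul_one]

theorem rpow_mul_min_one_div_rpow_le_of_num_le (hτ : 0 ≤ τ) (hq : τ ≤ q) (hx0 : x ≠ 0) (hx : x ≠ ∞)
    (h : v ≤ c * x) : x ^ τ * min 1 (v / x) ^ q ≤ c ^ (q - τ) * v ^ τ := by
  calc x ^ τ * min 1 (v / x) ^ q ≤ x ^ τ * (v / x) ^ q := by
        gcongr
        · exact hτ.trans hq
        · exact min_le_right _ _
    _ = (x * (v / x)) ^ τ * (v / x) ^ (q - τ) := by
        rw [ENNReal.mul_rpow_of_nonneg _ _ hτ, mul_assoc,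
          ← ENNReal.rpow_add_of_nonneg _ _ hτ (sub_nonneg.2 hq), add_sub_cancel]
    _ ≤ v ^ τ * c ^ (q - τ) := by
        rw [ENNReal.mul_div_cancel hx0 hx]
        gcongr
        exact ENNReal.div_le_of_le_mul h
    _ = c ^ (q - τ) * v ^ τ := mul_comm _ _

theorem tsum_rpow_mul_min_one_div_rpow_le (ha : 1 < a) (hatop : a ≠ ∞) (hτ : 0 ≤ τ) (hq : τ ≤ q)
    (hv : v ≠ ∞) : ∑' n : ℕ, (a ^ n) ^ τ * min 1 (v / a ^ n) ^ q ≤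
      ((1 - (a⁻¹) ^ τ)⁻¹ + (1 - (a⁻¹) ^ (q - τ))⁻¹) * v ^ τ := by
  have hpow0 (n : ℕ) : a ^ n ≠ 0 := pow_ne_zero n (zero_lt_one.trans ha).ne'
  have hpow (n : ℕ) : a ^ n ≠ ∞ := ENNReal.pow_ne_top hatop
  have hinv (k : ℕ) : (a⁻¹) ^ k * a ^ k = 1 := by
    rw [← ENNReal.inv_pow, ENNReal.inv_mul_cancel (hpow0 k) (hpow k)]
  obtain ⟨N, hN, hmin⟩ : ∃ N : ℕ, v < a ^ N ∧ ∀ n < N, a ^ n ≤ v := by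
    classical
    have hex : ∃ N : ℕ, v < a ^ N :=
      ((ENNReal.tendsto_pow_atTop_nhds_top_iff.2 ha).eventually (lt_mem_nhds hv.lt_top)).exists
    exact ⟨Nat.find hex, Nat.find_spec hex, fun n hn => not_lt.1 (Nat.find_min hex hn)⟩
  have hlow (n) (hn : n < N) : a ^ n ≤ (a⁻¹) ^ (N - 1 - n) * v := by
    calc a ^ n = (a⁻¹) ^ (N - 1 - n) * a ^ (N - 1) := by
          conv_rhs => rw [← Nat.sub_add_cancel (Nat.le_sub_one_of_lt hn), pow_add, ← mul_assoc,
            Nat.add_sub_cancel, hinv, one_mul]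
      _ ≤ _ := by gcongr; exact hmin _ (by lia)
  have hhigh (k : ℕ) : v ≤ (a⁻¹) ^ k * a ^ (k + N) := by
    rw [pow_add, ← mul_assoc, hinv, one_mul]
    exact hN.le
  calc ∑' n : ℕ, (a ^ n) ^ τ * min 1 (v / a ^ n) ^ q
      = ∑ n ∈ Finset.range N, (a ^ n) ^ τ * min 1 (v / a ^ n) ^ q +
          ∑' k : ℕ, (a ^ (k + N)) ^ τ * min 1 (v / a ^ (k + N)) ^ q :=
        ENNReal.summable.sum_add_tsum_nat_add'.symm
    _ ≤ ∑ n ∈ Finset.range N, ((a⁻¹) ^ (N - 1 - n)) ^ τ * v ^ τ +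
          ∑' k : ℕ, ((a⁻¹) ^ k) ^ (q - τ) * v ^ τ :=
        add_le_add
          (Finset.sum_le_sum fun n hn => rpow_mul_min_one_div_rpow_le_of_denom_le hτ (hτ.trans hq)
            (hlow n (Finset.mem_range.1 hn)))
          (ENNReal.tsum_le_tsum fun k => rpow_mul_min_one_div_rpow_le_of_num_le hτ hq
            (hpow0 _) (hpow _) (hhigh k))
    _ ≤ ∑' k : ℕ, ((a⁻¹) ^ k) ^ τ * v ^ τ + ∑' k : ℕ, ((a⁻¹) ^ k) ^ (q - τ) * v ^ τ := by
        rw [Finset.sum_range_reflect (fun k => ((a⁻¹) ^ k) ^ τ * v ^ τ)]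
        gcongr
        exact ENNReal.sum_le_tsum _
    _ = ((1 - (a⁻¹) ^ τ)⁻¹ + (1 - (a⁻¹) ^ (q - τ))⁻¹) * v ^ τ := by
        simp only [← ENNReal.rpow_natCast_mul, mul_comm (Nat.cast _), ENNReal.rpow_mul_natCast]
        rw [ENNReal.tsum_mul_right, ENNReal.tsum_mul_right, ENNReal.tsum_geometric,
          ENNReal.tsum_geometric, add_mul]

theorem exists_tsum_rpow_mul_min_one_div_rpow_le (ha : 1 < a) (hatop : a ≠ ∞) (hτ : 0 < τ)
    (hq : τ < q) : ∃ K : ℝ≥0, ∀ v : ℝ≥0∞,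
      ∑' n : ℕ, (a ^ n) ^ τ * min 1 (v / a ^ n) ^ q ≤ K * v ^ τ := by
  have hinv : a⁻¹ < 1 := ENNReal.inv_lt_one.2 ha
  have hx : (a⁻¹) ^ τ < 1 := ENNReal.rpow_lt_one hinv hτ
  have hy : (a⁻¹) ^ (q - τ) < 1 := ENNReal.rpow_lt_one hinv (sub_pos.2 hq)
  obtain ⟨K, hK⟩ : ∃ K : ℝ≥0, (K : ℝ≥0∞) = (1 - (a⁻¹) ^ τ)⁻¹ + (1 - (a⁻¹) ^ (q - τ))⁻¹ :=
    ⟨_, ENNReal.coe_toNNReal (by finiteness [(tsub_pos_of_lt hx).ne', (tsub_pos_of_lt hy).ne'])⟩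
  refine ⟨K, fun v => ?_⟩
  rcases eq_or_ne v ∞ with rfl | hv
  · have hK0 : (K : ℝ≥0∞) ≠ 0 := by simp [hK]
    simp [ENNReal.top_rpow_of_pos hτ, ENNReal.mul_top hK0]
  · exact hK ▸ tsum_rpow_mul_min_one_div_rpow_le ha hatop hτ.le hq.le hv

end GeometricSum

section PinchedGrowth

open Metric

variable {X : Type*} [MetricSpace X] [MeasurableSpace X] [OpensMeasurableSpace X] {μ : Measure X}
  {a b δ q : ℝ}

theorem min_le_setLIntegral_min {g g' : X → ℝ≥0∞} {A m s : ℝ≥0∞} (hs0 : s ≠ 0) (hs : s ≠ ∞)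
    {x : X} {R : ℝ} (hm : ∀ y, m ≤ μ (ball y 1)) (hg : ∀ y z, dist z y < 1 → g y ≤ g' z)
    (hA : A * s ≤ ∫⁻ y in ball x R, g y ∂μ) :
    min A m ≤ ∫⁻ y in ball x (R + 1), min 1 (g' y / s) ∂μ := by
  by_cases hlarge : ∃ y ∈ ball x R, s < g y
  · obtain ⟨y, hyx, hy⟩ := hlarge
    have hone : ∀ z ∈ ball y 1, 1 ≤ min 1 (g' z / s) := fun z hz =>
      le_min le_rfl <| (ENNReal.le_div_iff_mul_le (Or.inl hs0) (Or.inl hs)).2 <| by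
        rw [one_mul]
        exact hy.le.trans (hg y z hz)
    calc min A m ≤ ∫⁻ _ in ball y 1, 1 ∂μ := by
          rw [setLIntegral_one]
          exact (min_le_right A m).trans (hm y)
      _ ≤ ∫⁻ z in ball y 1, min 1 (g' z / s) ∂μ := setLIntegral_mono' measurableSet_ball hone
      _ ≤ ∫⁻ z in ball x (R + 1), min 1 (g' z / s) ∂μ :=
          lintegral_mono_set (ball_subset_ball' (by linarith [mem_ball.1 hyx]))
  · push Not at hlarge
    have hle : ∀ y ∈ ball x R, g y ≤ s * min 1 (g' y / s) := fun y hy => by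
      rw [mul_min, mul_one, ENNReal.mul_div_cancel hs0 hs]
      exact le_min (hlarge y hy) (hg y y (by simp))
    refine (min_le_left A m).trans ?_
    rw [← ENNReal.mul_le_mul_iff_right hs0 hs, mul_comm s A, ← lintegral_const_mul' s _ hs]
    calc A * s ≤ ∫⁻ y in ball x R, g y ∂μ := hA
      _ ≤ ∫⁻ y in ball x R, s * min 1 (g' y / s) ∂μ := setLIntegral_mono' measurableSet_ball hle
      _ ≤ ∫⁻ y in ball x (R + 1), s * min 1 (g' y / s) ∂μ :=
          lintegral_mono_set (ball_subset_ball (by linarith))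

theorem exists_measure_lt_setLIntegral_ball_le (hdbl : IsLocallyDoubling μ)
    (hlen : IsStrictlyIntrinsic X) (hhyp : IsGromovHyperbolic X δ)
    (hexp : HasPinchedExpGrowth μ a b) (hb : 1 < b) (hq1 : 1 ≤ q) (hq2 : q < 2) {A : ℝ≥0∞}
    (hA0 : A ≠ 0) (hA : A ≠ ∞) :
    ∃ K : ℝ≥0, ∀ (r : ℝ) (u : X → ℝ≥0∞), Measurable u → (∀ y, u y ≤ 1) →
      μ {x | A < ∫⁻ y in ball x r, u y ∂μ} ≤ K * ENNReal.ofReal (b ^ r) * ∫⁻ y, u y ^ q ∂μ := by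
  rcases isEmpty_or_nonempty X with _ | ⟨⟨o⟩⟩
  · exact ⟨0, fun r u _ _ => by simp [μ.eq_zero_of_isEmpty]⟩
  have := hdbl.sigmaFinite
  have := hdbl.secondCountableTopology
  obtain ⟨K, hK0, hK⟩ := exists_measure_horoballWeight_le hhyp hlen hexp hb
  have hKne : (K : ℝ≥0∞) ≠ 0 := ENNReal.coe_ne_zero.2 hK0.ne'
  have hq : ENNReal.ofReal (2 - q) ≠ 0 := (ENNReal.ofReal_pos.2 (sub_pos.2 hq2)).ne'
  have hA2 : A / 2 ≠ 0 := (ENNReal.half_pos hA0).ne'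
  set ε : ℝ≥0∞ := A / 2 * ENNReal.ofReal (2 - q) / K
  have hε0 : ε ≠ 0 := ENNReal.div_ne_zero.2 ⟨mul_ne_zero hA2 hq, ENNReal.coe_ne_top⟩
  have hε : ε ≠ ∞ := by finiteness
  have hAε : K * (ε / ENNReal.ofReal (2 - q)) + A / 2 = A := by
    rw [← mul_div_assoc, ENNReal.mul_div_cancel hKne ENNReal.coe_ne_top,
      ENNReal.mul_div_cancel_right hq ENNReal.ofReal_ne_top, ENNReal.add_halves]
  obtain ⟨K', hK'⟩ : ∃ K' : ℝ≥0, (K' : ℝ≥0∞) = K / ε / (A / 2) :=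
    ⟨_, ENNReal.coe_toNNReal (by finiteness)⟩
  refine ⟨K', fun r u hu hu1 => ?_⟩
  have hmain := measure_lt_setLIntegral_le (μ := μ) (ν := μ) (B := ENNReal.ofReal (b ^ r))
    (E := {p : X × X | dist p.2 p.1 < r}) (measurableSet_lt (by fun_prop) (by fun_prop))
    (measurable_horoballWeight b o r) (hK o · r)
    (measure_lt_horoballWeight_le (one_pos.trans hb) fun y => hK o y r) hu hu1 hq1 hq2 hε0 hε
    hA2 (by finiteness)
  rw [hAε] at hmain
  refine hmain.trans_eq ?_
  rw [hK']
  simp only [div_eq_mul_inv]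
  ring

theorem exists_mul_le_setLIntegral_ballAverage (hdbl : IsLocallyDoubling μ)
    (hexp : HasPinchedExpGrowth μ a b) (ha : 1 ≤ a) :
    ∃ A : ℝ≥0∞, A ≠ 0 ∧ A ≠ ∞ ∧ ∀ F : X → ℝ≥0∞, Measurable F → ∀ (x : X) (r : ℝ), 1 < r →
      ∀ t < ballAverage μ r F x, A * (t * ENNReal.ofReal a ^ ⌈r⌉₊) ≤
        ∫⁻ y in ball x (⌈r⌉₊ + 1), ballAverage μ 1 F y ∂μ := by
  obtain ⟨L, hL0, hL⟩ := hdbl.exists_setLIntegral_ball_le one_pos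
  obtain ⟨c, C, hc, -, hgrowth⟩ := hexp
  have ha0 : 0 < a := one_pos.trans_le ha
  have hL0' : (L : ℝ≥0∞) ≠ 0 := ENNReal.coe_ne_zero.2 hL0.ne'
  have hca : ENNReal.ofReal (c / a) ≠ 0 := (ENNReal.ofReal_pos.2 (by positivity)).ne'
  refine ⟨ENNReal.ofReal (c / a) / L, ENNReal.div_ne_zero.2 ⟨hca, ENNReal.coe_ne_top⟩,
    by finiteness, fun F hF x r hr t ht => ?_⟩
  have hvol : ENNReal.ofReal (c / a) * ENNReal.ofReal a ^ ⌈r⌉₊ ≤ μ (ball x r) := by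
    refine le_trans ?_ (hgrowth x r hr.le).1
    rw [← ENNReal.ofReal_pow ha0.le, ← ENNReal.ofReal_mul (by positivity)]
    refine ENNReal.ofReal_le_ofReal ?_
    calc c / a * a ^ ⌈r⌉₊ = c * a ^ ((⌈r⌉₊ : ℝ) - 1) := by
          rw [Real.rpow_sub_one ha0.ne', Real.rpow_natCast]
          ring
      _ ≤ c * a ^ r := by
          gcongr
          linarith [Nat.ceil_lt_add_one (one_pos.trans hr).le]
  have hmass : t * μ (ball x r) ≤ L * ∫⁻ y in ball x (⌈r⌉₊ + 1), ballAverage μ 1 F y ∂μ :=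
    calc t * μ (ball x r) ≤ ∫⁻ y in ball x r, F y ∂μ := by
          rw [ballAverage_eq_div] at ht
          exact ENNReal.mul_le_of_le_div ht.le
      _ ≤ ∫⁻ y in ball x ⌈r⌉₊, F y ∂μ := lintegral_mono_set (ball_subset_ball (Nat.le_ceil r))
      _ ≤ _ := hL F hF x _
  rw [ENNReal.mul_comm_div, ← mul_div_assoc]
  refine ENNReal.div_le_of_le_mul' (le_trans ?_ hmass)
  calc ENNReal.ofReal (c / a) * (t * ENNReal.ofReal a ^ ⌈r⌉₊)
      = t * (ENNReal.ofReal (c / a) * ENNReal.ofReal a ^ ⌈r⌉₊) := mul_left_comm ..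
    _ ≤ t * μ (ball x r) := by gcongr

theorem exists_lt_setLIntegral_min_ballAverage (hdbl : IsLocallyDoubling μ)
    (hexp : HasPinchedExpGrowth μ a b) (ha : 1 ≤ a) :
    ∃ (A : ℝ≥0∞) (L : ℝ≥0), A ≠ 0 ∧ A ≠ ∞ ∧ ∀ F : X → ℝ≥0∞, Measurable F →
      ∀ (x : X) (r : ℝ), 1 < r → ∀ t : ℝ≥0∞, t ≠ 0 → t < ballAverage μ r F x →
        A < ∫⁻ y in ball x (⌈r⌉₊ + 2),
          min 1 (L * ballAverage μ 2 F y / t / ENNReal.ofReal a ^ ⌈r⌉₊) ∂μ := by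
  obtain ⟨A, hA0, hA, hmass⟩ := exists_mul_le_setLIntegral_ballAverage hdbl hexp ha
  obtain ⟨L, hL⟩ := hdbl.exists_ballAverage_le_ballAverage one_pos
  obtain ⟨c, C, hc, -, hgrowth⟩ := hexp
  have ha0 : 0 < a := one_pos.trans_le ha
  have hm (y : X) : ENNReal.ofReal (c * a) ≤ μ (ball y 1) := by
    simpa using (hgrowth y 1 le_rfl).1
  have hmin0 : min A (ENNReal.ofReal (c * a)) ≠ 0 :=
    (lt_min hA0.bot_lt (ENNReal.ofReal_pos.2 (by positivity))).ne'
  have hmin : min A (ENNReal.ofReal (c * a)) ≠ ∞ := ne_top_of_le_ne_top hA (min_le_left _ _)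
  refine ⟨min A (ENNReal.ofReal (c * a)) / 2, L, (ENNReal.half_pos hmin0).ne', by finiteness,
    fun F hF x r hr t ht0 ht => ?_⟩
  have hs0 : t * ENNReal.ofReal a ^ ⌈r⌉₊ ≠ 0 :=
    mul_ne_zero ht0 (pow_ne_zero _ (ENNReal.ofReal_pos.2 ha0).ne')
  have hs : t * ENNReal.ofReal a ^ ⌈r⌉₊ ≠ ∞ := by finiteness [ht.ne_top]
  calc min A (ENNReal.ofReal (c * a)) / 2 < min A (ENNReal.ofReal (c * a)) :=
        ENNReal.half_lt_self hmin0 hmin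
    _ ≤ ∫⁻ y in ball x (⌈r⌉₊ + 1 + 1),
          min 1 (L * ballAverage μ (2 * 1) F y / (t * ENNReal.ofReal a ^ ⌈r⌉₊)) ∂μ :=
        min_le_setLIntegral_min hs0 hs hm (hL F) (hmass F hF x r hr t ht)
    _ = _ := by
        simp only [add_assoc, one_add_one_eq_two, mul_one, div_eq_mul_inv,
          ENNReal.mul_inv (Or.inl ht0) (Or.inl ht.ne_top), mul_assoc]

theorem exists_tsum_measure_lt_setLIntegral_min_le (hdbl : IsLocallyDoubling μ)
    (hlen : IsStrictlyIntrinsic X) (hhyp : IsGromovHyperbolic X δ)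
    (hexp : HasPinchedExpGrowth μ a b) (ha : 1 < a) (hab : a ≤ b) (hb : b < a ^ 2) {A : ℝ≥0∞}
    (hA0 : A ≠ 0) (hA : A ≠ ∞) :
    ∃ K : ℝ≥0, ∀ v : X → ℝ≥0∞, Measurable v →
      ∑' n : ℕ, μ {x | A < ∫⁻ y in ball x (n + 2), min 1 (v y / ENNReal.ofReal a ^ n) ∂μ} ≤
        K * ∫⁻ y, v y ^ Real.logb a b ∂μ := by
  have ha0 : 0 < a := one_pos.trans ha
  have hb1 : 1 < b := ha.trans_le hab
  have hb0 : 0 < b := one_pos.trans hb1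
  set τ := Real.logb a b
  set α := ENNReal.ofReal a
  have hτ1 : 1 ≤ τ := (Real.le_logb_iff_rpow_le ha hb0).2 (by rwa [Real.rpow_one])
  have hτ2 : τ < 2 := (Real.logb_lt_iff_lt_rpow ha hb0).2 (by exact_mod_cast hb)
  obtain ⟨q, hτq, hq2⟩ := exists_between hτ2
  obtain ⟨K, hK⟩ := exists_measure_lt_setLIntegral_ball_le hdbl hlen hhyp hexp hb1
    (hτ1.trans hτq.le) hq2 hA0 hA
  obtain ⟨S, hS⟩ := exists_tsum_rpow_mul_min_one_div_rpow_le (ENNReal.one_lt_ofReal.2 ha)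
    ENNReal.ofReal_ne_top (one_pos.trans_le hτ1) hτq
  have hpow (n : ℕ) : ENNReal.ofReal (b ^ (n + 2 : ℝ)) =
      ENNReal.ofReal (b ^ 2) * (α ^ n) ^ τ := by
    rw [Real.rpow_add hb0, mul_comm, ENNReal.ofReal_mul (by positivity), Real.rpow_ofNat,
      Real.rpow_natCast, ENNReal.ofReal_pow hb0.le n, ← ENNReal.rpow_natCast_mul,
      mul_comm (n : ℝ), ENNReal.rpow_mul_natCast, ENNReal.ofReal_rpow_of_pos ha0,
      Real.rpow_logb ha0 ha.ne' hb0]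
  refine ⟨K * (b ^ 2).toNNReal * S, fun v hv => ?_⟩
  set u : ℕ → X → ℝ≥0∞ := fun n y => min 1 (v y / α ^ n)
  have hu (n : ℕ) : Measurable (u n) := measurable_const.min (hv.div_const _)
  calc ∑' n : ℕ, μ {x | A < ∫⁻ y in ball x (n + 2), u n y ∂μ}
      ≤ ∑' n : ℕ, K * ENNReal.ofReal (b ^ (n + 2 : ℝ)) * ∫⁻ y, u n y ^ q ∂μ :=
        ENNReal.tsum_le_tsum fun n => hK _ (u n) (hu n) fun y => min_le_left _ _
    _ = K * ENNReal.ofReal (b ^ 2) * ∫⁻ y, ∑' n : ℕ, (α ^ n) ^ τ * u n y ^ q ∂μ := by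
        rw [lintegral_tsum fun n => (((hu n).pow_const q).const_mul _).aemeasurable,
          ← ENNReal.tsum_mul_left]
        refine tsum_congr fun n => ?_
        rw [lintegral_const_mul _ ((hu n).pow_const q), hpow]
        ring
    _ ≤ K * ENNReal.ofReal (b ^ 2) * ∫⁻ y, S * v y ^ τ ∂μ := by
        gcongr
        exact hS _
    _ = ↑(K * (b ^ 2).toNNReal * S) * ∫⁻ y, v y ^ τ ∂μ := by
        rw [lintegral_const_mul _ (hv.pow_const τ), ← mul_assoc, ENNReal.coe_mul, ENNReal.coe_mul,
          ENNReal.ofReal]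

theorem isWeakTypeOnNonneg_truncatedMaximal_Ioi (hdbl : IsLocallyDoubling μ)
    (hlen : IsStrictlyIntrinsic X) (hhyp : IsGromovHyperbolic X δ)
    (hexp : HasPinchedExpGrowth μ a b) (ha : 1 < a) (hab : a ≤ b) (hb : b < a ^ 2) :
    IsWeakTypeOnNonneg μ (truncatedMaximal μ (Ioi 1)) (Real.logb a b) := by
  set τ := Real.logb a b
  have hτ1 : 1 ≤ τ :=
    (Real.le_logb_iff_rpow_le ha (by linarith)).2 (by rwa [Real.rpow_one])
  have hτ0 : 0 ≤ τ := zero_le_one.trans hτ1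
  obtain ⟨A, L, hA0, hA, hlarge⟩ := exists_lt_setLIntegral_min_ballAverage hdbl hexp ha.le
  obtain ⟨K, hK⟩ := exists_tsum_measure_lt_setLIntegral_min_le hdbl hlen hhyp hexp ha hab hb hA0 hA
  obtain ⟨M, hM⟩ := hdbl.exists_lintegral_ballAverage_rpow_le two_pos hτ1
  refine ⟨K * (L ^ τ * M), fun F hF t ht0 _ => ?_⟩
  have hmeas := measurable_ballAverage μ 2 F
  calc μ {x | t < truncatedMaximal μ (Ioi 1) F x}
      ≤ μ (⋃ n : ℕ, {x | A < ∫⁻ y in ball x (n + 2),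
          min 1 (L * ballAverage μ 2 F y / t / ENNReal.ofReal a ^ n) ∂μ}) := by
        refine measure_mono fun x (hx : t < ⨆ r ∈ Ioi (1 : ℝ), _) => ?_
        obtain ⟨r, hr, hxr⟩ := lt_biSup_iff.1 hx
        exact mem_iUnion.2 ⟨⌈r⌉₊, hlarge F hF x r hr t ht0 hxr⟩
    _ ≤ K * ∫⁻ y, (L * ballAverage μ 2 F y / t) ^ τ ∂μ :=
        (measure_iUnion_le _).trans (hK _ ((hmeas.const_mul _).div_const t))
    _ = K * (L ^ τ * ∫⁻ y, ballAverage μ 2 F y ^ τ ∂μ) / t ^ τ := by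
        simp only [ENNReal.div_rpow_of_nonneg _ _ hτ0, ENNReal.mul_rpow_of_nonneg _ _ hτ0]
        simp only [div_eq_mul_inv]
        rw [lintegral_mul_const _ ((hmeas.pow_const τ).const_mul _),
          lintegral_const_mul _ (hmeas.pow_const τ), ← mul_assoc]
    _ ≤ K * (L ^ τ * (M * ∫⁻ y, F y ^ τ ∂μ)) / t ^ τ := by
        gcongr
        exact hM F hF
    _ = ↑(K * (L ^ τ * M)) * (∫⁻ y, F y ^ τ ∂μ) / t ^ τ := by
        rw [ENNReal.coe_mul, ENNReal.coe_mul, ENNReal.coe_rpow_of_nonneg _ hτ0, mul_assoc,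
          mul_assoc]

end PinchedGrowth

section MaximalFunction

variable {X : Type*} [MetricSpace X] [MeasurableSpace X] {μ : Measure X} {f : X → ℂ} {τ : ℝ}

theorem maximalFunction_eq_truncatedMaximal {F : X → ℝ≥0∞} (h : (‖f ·‖ₑ) =ᵐ[μ] F) :
    maximalFunction μ f = truncatedMaximal μ (Ioi 0) F := by
  rw [← truncatedMaximal_congr_ae _ h]
  ext x
  simp only [maximalFunction, truncatedMaximal, ballAverage_eq_div, ENNReal.div_eq_inv_mul, mem_Ioi]

variable [OpensMeasurableSpace X]

theorem aemeasurable_maximalFunction (hf : AEStronglyMeasurable f μ) :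
    AEMeasurable (maximalFunction μ f) μ := by
  rw [maximalFunction_eq_truncatedMaximal hf.enorm.ae_eq_mk]
  exact (measurable_truncatedMaximal isOpen_Ioi μ _).aemeasurable

theorem isBoundedOnLp_top_maximalFunction (μ : Measure X) :
    IsBoundedOnLp μ (maximalFunction μ) ∞ := by
  refine ⟨1, fun f hf => ⟨aemeasurable_maximalFunction hf.1, ?_⟩⟩
  rw [maximalFunction_eq_truncatedMaximal (Filter.EventuallyEq.refl _ _), ENNReal.coe_one, one_mul,
    eLpNorm_exponent_top, eLpNorm_exponent_top]
  exact essSup_le_of_ae_le _ (.of_forall fun x => truncatedMaximal_le_essSup (Ioi 0) _ x)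

theorem IsWeakTypeOnNonneg.isWeakType_maximalFunction
    (h : IsWeakTypeOnNonneg μ (truncatedMaximal μ (Ioi 0)) τ) (hτ : 0 < τ) :
    IsWeakType μ (maximalFunction μ) τ := by
  obtain ⟨K, hK⟩ := h
  refine ⟨K, fun f hf => ⟨aemeasurable_maximalFunction hf.1, fun t ht => ?_⟩⟩
  have hF := hf.1.enorm
  rw [maximalFunction_eq_truncatedMaximal hF.ae_eq_mk]
  calc μ {x | (t : ℝ≥0∞) < truncatedMaximal μ (Ioi 0) (hF.mk _) x}
      ≤ K * (∫⁻ x, hF.mk _ x ^ τ ∂μ) / t ^ τ :=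
        hK _ hF.measurable_mk t (ENNReal.coe_ne_zero.2 ht.ne') ENNReal.coe_ne_top
    _ = K * (∫⁻ x, ‖f x‖ₑ ^ τ ∂μ) / t ^ τ := by
        rw [lintegral_congr_ae (hF.ae_eq_mk.mono fun x hx => congrArg (· ^ τ) hx)]
    _ = K * (eLpNorm f (ENNReal.ofReal τ) μ / t) ^ τ := by
        rw [ENNReal.div_rpow_of_nonneg _ _ hτ.le,
          eLpNorm_eq_lintegral_rpow_enorm_toReal (ENNReal.ofReal_pos.2 hτ).ne'
            ENNReal.ofReal_ne_top,
          ENNReal.toReal_ofReal hτ.le, ← ENNReal.rpow_mul, one_div_mul_cancel hτ.ne',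
          ENNReal.rpow_one, mul_div_assoc]

theorem IsWeakTypeOnNonneg.isBoundedOnLp_maximalFunction
    (h : IsWeakTypeOnNonneg μ (truncatedMaximal μ (Ioi 0)) τ) (hτ : 0 < τ) {p : ℝ≥0∞}
    (hp : ENNReal.ofReal τ < p) : IsBoundedOnLp μ (maximalFunction μ) p := by
  rcases eq_or_ne p ∞ with rfl | hptop
  · exact isBoundedOnLp_top_maximalFunction μ
  have hp0 : p ≠ 0 := hp.ne_bot
  obtain ⟨K, hK⟩ := h.exists_lintegral_rpow_le hτ
    ((ENNReal.ofReal_lt_iff_lt_toReal hτ.le hptop).1 hp)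
    (fun F _ => measurable_truncatedMaximal isOpen_Ioi μ F)
    fun _ _ _ hFG => truncatedMaximal_le_add_const hFG
  refine ⟨K ^ (1 / p.toReal), fun f hf => ⟨aemeasurable_maximalFunction hf.1, ?_⟩⟩
  have hF := hf.1.enorm
  rw [maximalFunction_eq_truncatedMaximal hF.ae_eq_mk,
    eLpNorm_eq_lintegral_rpow_enorm_toReal hp0 hptop,
    eLpNorm_eq_lintegral_rpow_enorm_toReal hp0 hptop,
    ENNReal.coe_rpow_of_nonneg _ (by positivity), ← ENNReal.mul_rpow_of_nonneg _ _ (by positivity)]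
  gcongr
  calc ∫⁻ x, ‖truncatedMaximal μ (Ioi 0) (hF.mk _) x‖ₑ ^ p.toReal ∂μ
      ≤ K * ∫⁻ x, hF.mk _ x ^ p.toReal ∂μ := hK _ hF.measurable_mk
    _ = K * ∫⁻ x, ‖f x‖ₑ ^ p.toReal ∂μ := by
        rw [lintegral_congr_ae (hF.ae_eq_mk.mono fun x hx => congrArg (· ^ p.toReal) hx)]

end MaximalFunction

theorem theorem1p1_general {X : Type*} [MetricSpace X] [MeasurableSpace X]
    [OpensMeasurableSpace X] {μ : Measure X} {a b δ : ℝ} (ha : 1 < a) (hab : a ≤ b)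
    (hb : b < a ^ 2) (hlen : IsStrictlyIntrinsic X) (hhyp : IsGromovHyperbolic X δ)
    (hdbl : IsLocallyDoubling μ) (hexp : HasPinchedExpGrowth μ a b) :
    (∀ p : ℝ≥0∞, ENNReal.ofReal (Real.logb a b) < p →
      IsBoundedOnLp μ (maximalFunction μ) p) ∧
    IsWeakType μ (maximalFunction μ) (Real.logb a b) := by
  have hτ1 : 1 ≤ Real.logb a b :=
    (Real.le_logb_iff_rpow_le ha (by linarith)).2 (by rwa [Real.rpow_one])
  have hτ0 : 0 < Real.logb a b := one_pos.trans_le hτ1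
  have hlocal := hdbl.isWeakTypeOnNonneg_truncatedMaximal one_pos hτ1
  have hglobal := isWeakTypeOnNonneg_truncatedMaximal_Ioi hdbl hlen hhyp hexp ha hab hb
  have hweak : IsWeakTypeOnNonneg μ (truncatedMaximal μ (Ioi 0)) (Real.logb a b) := by
    rw [← Ioc_union_Ioi_eq_Ioi zero_le_one]
    simpa only [← truncatedMaximal_union] using hlocal.sup hglobal
  exact ⟨fun p hp => hweak.isBoundedOnLp_maximalFunction hτ0 hp,
    hweak.isWeakType_maximalFunction hτ0⟩

theorem theorem1p1 {X : Type*} [MetricSpace X] [ConnectedSpace X] [NoncompactSpace X]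
    [CompleteSpace X] [MeasurableSpace X] [BorelSpace X] (μ : Measure X)
    (a b δ : ℝ) (ha : 1 < a) (hab : a ≤ b) (hb : b < a ^ 2) (hδ : 0 ≤ δ)
    (hlen : IsStrictlyIntrinsic X) (hhyp : IsGromovHyperbolic X δ)
    (hdbl : IsLocallyDoubling μ) (hexp : HasPinchedExpGrowth μ a b) :
    (∀ p : ℝ≥0∞, ENNReal.ofReal (Real.logb a b) < p →
      IsBoundedOnLp μ (maximalFunction μ) p) ∧
    IsWeakType μ (maximalFunction μ) (Real.logb a b) :=
  theorem1p1_general ha hab hb hlen hhyp hdbl hexp
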